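/- Let $G$ be a Lie group of dimension $n\ge 3$ with Lie algebra $\mathfrak g$ such that every left-invariant Riemannian metric on $G$ has non-positive scalar curvature, and let $I=[t_0,\infty)$. Let $\gamma\in C^2(I,T^0_2\mathfrak g)$ be a family of Riemannian metrics (inner products) on $\mathfrak g$, let $\rho\in C^1(I)$, $j\in C^1(I,T^0_1\mathfrak g)$, $S\in C^1(I,T^0_2\mathfrak g)$ with $S$ symmetric, and let $\phi\in C^2(I,J)$, where $J\subset\mathbb R$ is an interval with non-empty interior. Identify tensors on $\mathfrak g$ with left-invariant tensor fields on $G$ and, with the projections $\pi:G\times I\to G$ and $t:G\times I\to I$, put on $M=G\times I$ $$g=\pi^*\gamma-dt\otimes dt,\qquad T=\pi^*S-\pi^*j\otimes dt-dt\otimes\pi^*j+\rho\,dt\otimes dt .$$ Let $V,C\in C^1(J)$ and $c\in C(J)$, and suppose that the coupled Einstein--scalar field--matter equations hold on $M$: $$\mathrm{Rc}_g-\tfrac12R_g\,g=\nabla\phi\otimes\nabla\phi-\tfrac12|\nabla\phi|_g^2\,g-V(\phi)\,g+C(\phi)\,T,$$ $$\Box_g\phi-V'(\phi)=-c(\phi)\,\mathrm{tr}_gT,\qquad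 \mathrm{div}_g\big(C(\phi)T\big)=c(\phi)\,(\mathrm{tr}_gT)\,\nabla\phi .$$ Assume on $I$ that $|j|_\gamma\le\rho$, $|\mathrm{tr}_\gamma S|\le n\rho$ and $\rho+\mathrm{tr}_\gamma S\ge0$. Assume that $C\ge0$ and that there is a constant $C_0$ with $|c|\le C_0C$ on $J$. Assume that $V>0$ on $J$ and that * there is a lower semi-continuous function $\bar V>0$ on the closure of $J$ in $\mathbb R$ with $V\ge\bar V$ on $J$; * $V'$ is bounded on every subset of $J$ on which $V$ is bounded; * $V'$ extends to a continuous function with values in $[-\infty,\infty]$ on the closure of $J$ in $[-\infty,\infty]$. Let $k=-\tfrac12\dot\gamma$, $H=-\tfrac1n\mathrm{tr}_\gamma k$ and $\sigma=k+H\gamma$ (the shear), let $R_\gamma$ be the scalar curvature of the left-invariant metric $\gamma(t)$ on $G$, and assume $H(t_0)>0$. No positive lower bound on $V\circ\phi$ is assumed. Then $$R_\gamma,\quad |\sigma|_\gamma^2,\quad C(\phi)\rho,\quad C(\phi)|j|_\gamma,\quad C(\phi)\,\mathrm{tr}_\gamma S,\quad c(\phi)\,\mathrm{tr}_gT$$ are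 all $\mathcal O(t^{-2})$ as $t\to\infty$. -/

import Mathlib

open Set Filter Topology Asymptotics
open scoped Manifold ContDiff

noncomputable section

namespace Quintessence

/-! ### Tensor algebra with respect to a (pseudo-)metric on a finite-dimensional space -/

section TensorAlgebra

variable {A : Type*} [NormedAddCommGroup A] [NormedSpace ℝ A]

/-- Covariant 2-tensors (bilinear forms) on `A`. -/
abbrev Tensor2 (A : Type*) [NormedAddCommGroup A] [NormedSpace ℝ A] : Type _ := A →L[ℝ] A →L[ℝ] ℝ

/-- Tensor product of two covectors, `(α ⊗ β)(X, Y) = α X * β Y`. -/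
def tensorProd (α β : A →L[ℝ] ℝ) : Tensor2 A := α.smulRight β

/-- Raising an index: the inverse of `X ↦ g(X, ·)`, for a non-degenerate symmetric `g`. -/
def sharp (g : Tensor2 A) : (A →L[ℝ] ℝ) →L[ℝ] A := ContinuousLinearMap.inverse g

/-- The endomorphism obtained from a 2-tensor by raising its second index. -/
def raise (g B : Tensor2 A) : A →L[ℝ] A := (sharp g).comp B

/-- The trace `g^{ab} B_{ab}`. -/
def metricTrace (g B : Tensor2 A) : ℝ := LinearMap.trace ℝ A (raise g B : A →ₗ[ℝ] A)

/-- The inner product `g^{ab} α_a β_b` of two covectors. -/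
def covectorInner (g : Tensor2 A) (α β : A →L[ℝ] ℝ) : ℝ := α (sharp g β)

/-- The inner product `g^{ac} g^{bd} B_{ab} D_{cd}` of two 2-tensors. -/
def tensorInner (g B D : Tensor2 A) : ℝ :=
  LinearMap.trace ℝ A ((raise g B).comp (raise g D.flip) : A →ₗ[ℝ] A)

/-- Symmetric and positive definite bilinear forms. -/
structure IsInnerProduct (h : Tensor2 A) : Prop where
  symm : ∀ x y, h x y = h y x
  pos : ∀ x, x ≠ 0 → 0 < h x x

end TensorAlgebra

/-! ### Invariant tensor calculus

`A` is the space of time-independent invariant vector fields of a homogeneous space-time (or of a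
Lie group), `br` is their Lie bracket, and `τ = dt` is the time differential, so
that a vector field `X ∈ A` acts on a function `f` of time by `X f = τ(X) f'`. An invariant tensor
field is a function of time with values in the tensors on `A`. Time runs in the interval `s`. -/

section InvariantCalculus

variable {A : Type*} [NormedAddCommGroup A] [NormedSpace ℝ A]

/-- Koszul's formula: the 1-form `Z ↦ g(∇_X Y, Z)` for invariant fields `X`, `Y`, where
`2 g(∇_X Y, Z) = X g(Y,Z) + Y g(X,Z) - Z g(X,Y) + g([X,Y],Z) - g(Y,[X,Z]) - g(X,[Y,Z])`. -/
def koszul (br : A →L[ℝ] A →L[ℝ] A) (τ : A →L[ℝ] ℝ) (s : Set ℝ) (g : ℝ → Tensor2 A) (t : ℝ)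
    (X Y : A) : A →L[ℝ] ℝ :=
  (1 / 2 : ℝ) • (τ X • derivWithin g s t Y + τ Y • derivWithin g s t X
    - derivWithin g s t X Y • τ
    + g t (br X Y) - (g t Y).comp (br X) - (g t X).comp (br Y))

variable [FiniteDimensional ℝ A]

/-- The Levi-Civita connection: `christoffel … t X Y = ∇_X Y` at time `t`. -/
def christoffel (br : A →L[ℝ] A →L[ℝ] A) (τ : A →L[ℝ] ℝ) (s : Set ℝ) (g : ℝ → Tensor2 A)
    (t : ℝ) : A →L[ℝ] A →L[ℝ] A :=
  (LinearMap.mk₂ ℝ (fun X Y => sharp (g t) (koszul br τ s g t X Y))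
    (fun X X' Y => by
      rw [← map_add]; congr 1; ext Z; simp [koszul]; ring)
    (fun c X Y => by
      rw [← map_smul]; congr 1; ext Z; simp [koszul]; ring)
    (fun X Y Y' => by
      rw [← map_add]; congr 1; ext Z; simp [koszul]; ring)
    (fun c X Y => by
      rw [← map_smul]; congr 1; ext Z; simp [koszul]; ring)).toContinuousBilinearMap

/-- The curvature `R(X,Y)Z = ∇_X ∇_Y Z - ∇_Y ∇_X Z - ∇_{[X,Y]} Z` for invariant fields; the field
`W = ∇_Y Z` depends on time, and `∇_X W = Γ(X, W) + τ(X) W'`. -/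
def riemann (br : A →L[ℝ] A →L[ℝ] A) (τ : A →L[ℝ] ℝ) (s : Set ℝ) (g : ℝ → Tensor2 A)
    (t : ℝ) (X Y Z : A) : A :=
  let Γ := christoffel br τ s g t
  let Γ' := derivWithin (christoffel br τ s g) s t
  (Γ X (Γ Y Z) + τ X • Γ' Y Z) - (Γ Y (Γ X Z) + τ Y • Γ' X Z) - Γ (br X Y) Z

/-- The Ricci tensor `Rc(Y,Z) = tr (X ↦ R(X,Y)Z)`. -/
def ricci (br : A →L[ℝ] A →L[ℝ] A) (τ : A →L[ℝ] ℝ) (s : Set ℝ) (g : ℝ → Tensor2 A)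
    (t : ℝ) : Tensor2 A :=
  let R (Y Z : A) : A →ₗ[ℝ] A :=
    { toFun := fun X => riemann br τ s g t X Y Z
      map_add' := fun X X' => by
        simp only [riemann, map_add, add_apply, add_smul, smul_add]; abel
      map_smul' := fun c X => by
        simp only [riemann, map_smul, smul_apply, smul_sub, smul_add,
          RingHom.id_apply, smul_smul, smul_eq_mul, mul_comm c] }
  (LinearMap.mk₂ ℝ (fun Y Z => LinearMap.trace ℝ A (R Y Z))
    (fun Y Y' Z => by
      rw [← map_add]; congr 1; ext X
      simp only [R, riemann, map_add, add_apply, LinearMap.add_apply,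
        LinearMap.coe_mk, AddHom.coe_mk, add_smul, smul_add]
      abel)
    (fun c Y Z => by
      rw [← map_smul]; congr 1; ext X
      simp only [R, riemann, map_smul, smul_apply, LinearMap.smul_apply,
        LinearMap.coe_mk, AddHom.coe_mk, smul_sub, smul_add, smul_smul, smul_eq_mul, mul_comm c])
    (fun Y Z Z' => by
      rw [← map_add]; congr 1; ext X
      simp only [R, riemann, map_add, LinearMap.add_apply,
        LinearMap.coe_mk, AddHom.coe_mk, smul_add]
      abel)
    (fun c Y Z => by
      rw [← map_smul]; congr 1; ext X
      simp only [R, riemann, map_smul, LinearMap.smul_apply,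
        LinearMap.coe_mk, AddHom.coe_mk, smul_sub, smul_add, smul_smul,
        mul_comm c])).toContinuousBilinearMap

/-- The scalar curvature. -/
def scalarCurvature (br : A →L[ℝ] A →L[ℝ] A) (τ : A →L[ℝ] ℝ) (s : Set ℝ) (g : ℝ → Tensor2 A)
    (t : ℝ) : ℝ :=
  metricTrace (g t) (ricci br τ s g t)

/-- The covariant derivative `(∇_X α)(Y)` of an invariant 1-form, as a 2-tensor in `(X, Y)`. -/
def covDerivForm (br : A →L[ℝ] A →L[ℝ] A) (τ : A →L[ℝ] ℝ) (s : Set ℝ) (g : ℝ → Tensor2 A)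
    (α : ℝ → A →L[ℝ] ℝ) (t : ℝ) : Tensor2 A :=
  (LinearMap.mk₂ ℝ
    (fun X Y => τ X * derivWithin α s t Y - α t (christoffel br τ s g t X Y))
    (fun X X' Y => by simp; ring) (fun c X Y => by simp; ring)
    (fun X Y Y' => by simp; ring) (fun c X Y => by simp; ring)).toContinuousBilinearMap

/-- The covariant derivative `(∇_X B)(Y, Z)` of an invariant 2-tensor, with `Z` fixed, as a
2-tensor in `(X, Y)`. -/
def covDerivTensor (br : A →L[ℝ] A →L[ℝ] A) (τ : A →L[ℝ] ℝ) (s : Set ℝ) (g : ℝ → Tensor2 A)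
    (B : ℝ → Tensor2 A) (t : ℝ) (Z : A) : Tensor2 A :=
  (LinearMap.mk₂ ℝ
    (fun X Y => τ X * derivWithin B s t Y Z - B t (christoffel br τ s g t X Y) Z
      - B t Y (christoffel br τ s g t X Z))
    (fun X X' Y => by simp; ring) (fun c X Y => by simp; ring)
    (fun X Y Y' => by simp; ring) (fun c X Y => by simp; ring)).toContinuousBilinearMap

/-- The divergence `Z ↦ g^{ab} (∇_a B)(e_b, Z)` of an invariant 2-tensor. -/
def divergence (br : A →L[ℝ] A →L[ℝ] A) (τ : A →L[ℝ] ℝ) (s : Set ℝ) (g : ℝ → Tensor2 A)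
    (B : ℝ → Tensor2 A) (t : ℝ) (Z : A) : ℝ :=
  metricTrace (g t) (covDerivTensor br τ s g B t Z)

/-- The differential `dφ = φ' dt` of a function of time. -/
def differential (τ : A →L[ℝ] ℝ) (s : Set ℝ) (φ : ℝ → ℝ) (t : ℝ) : A →L[ℝ] ℝ :=
  derivWithin φ s t • τ

/-- The wave operator `□φ = tr_g (∇ dφ)`. -/
def box (br : A →L[ℝ] A →L[ℝ] A) (τ : A →L[ℝ] ℝ) (s : Set ℝ) (g : ℝ → Tensor2 A)
    (φ : ℝ → ℝ) (t : ℝ) : ℝ :=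
  metricTrace (g t) (covDerivForm br τ s g (differential τ s φ) t)

end InvariantCalculus

/-! ### Left-invariant geometry of a Lie group and of the space-time `G × I` -/

section LieGroup

variable (E : Type*) [NormedAddCommGroup E] [NormedSpace ℝ E] [FiniteDimensional ℝ E]

/-- The bracket of the Lie algebra `𝔤 = T₁G` of left-invariant vector fields on `G`, as a bilinear
map on the model space `E` (which is, by definition, the tangent space `T₁G`). -/
def lieBracket (G : Type*) [TopologicalSpace G] [ChartedSpace E G] [Group G]
    [LieGroup 𝓘(ℝ, E) ∞ G] : E →L[ℝ] E →L[ℝ] E :=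
  haveI : CompleteSpace E := FiniteDimensional.complete ℝ E
  haveI : LieGroup 𝓘(ℝ, E) (minSmoothness ℝ 3) G := by
    rw [minSmoothness_of_isRCLikeNormedField]; infer_instance
  (LinearMap.mk₂ ℝ
    (fun x y : E => @Bracket.bracket (GroupLieAlgebra 𝓘(ℝ, E) G) (GroupLieAlgebra 𝓘(ℝ, E) G) _ x y)
    (fun x x' y => add_lie (L := GroupLieAlgebra 𝓘(ℝ, E) G) (M := GroupLieAlgebra 𝓘(ℝ, E) G) x x' y)
    (fun r x y => smul_lie (R := ℝ) (L := GroupLieAlgebra 𝓘(ℝ, E) G)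
      (M := GroupLieAlgebra 𝓘(ℝ, E) G) r x y)
    (fun x y y' => lie_add (L := GroupLieAlgebra 𝓘(ℝ, E) G) (M := GroupLieAlgebra 𝓘(ℝ, E) G) x y y')
    (fun r x y => lie_smul (R := ℝ) (L := GroupLieAlgebra 𝓘(ℝ, E) G)
      (M := GroupLieAlgebra 𝓘(ℝ, E) G) r x y)).toContinuousBilinearMap

end LieGroup

section SpaceTime

variable {E : Type*} [NormedAddCommGroup E] [NormedSpace ℝ E]

/-- The time differential `dt` on `𝔤 × ℝ`. -/
def dt : E × ℝ →L[ℝ] ℝ := ContinuousLinearMap.snd ℝ E ℝ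

/-- Pullback along the projection `𝔤 × ℝ → 𝔤` of a covector. -/
def pullForm (α : E →L[ℝ] ℝ) : E × ℝ →L[ℝ] ℝ := α.comp (ContinuousLinearMap.fst ℝ E ℝ)

/-- Pullback along the projection `𝔤 × ℝ → 𝔤` of a 2-tensor. -/
def pullTensor (B : Tensor2 E) : Tensor2 (E × ℝ) :=
  B.bilinearComp (ContinuousLinearMap.fst ℝ E ℝ) (ContinuousLinearMap.fst ℝ E ℝ)

/-- The space-time metric `g = π^* γ - dt ⊗ dt`. -/
def spacetimeMetric (γ : ℝ → Tensor2 E) (t : ℝ) : Tensor2 (E × ℝ) :=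
  pullTensor (γ t) - tensorProd dt dt

/-- The energy-momentum tensor `T = π^* S - π^* j ⊗ dt - dt ⊗ π^* j + ρ dt ⊗ dt`. -/
def energyMomentum (ρ : ℝ → ℝ) (j : ℝ → E →L[ℝ] ℝ) (S : ℝ → Tensor2 E) (t : ℝ) :
    Tensor2 (E × ℝ) :=
  pullTensor (S t) - tensorProd (pullForm (j t)) dt - tensorProd dt (pullForm (j t))
    + ρ t • tensorProd dt dt

/-- The bracket of the fields `x + a ∂_t` on `G × I` with `x ∈ 𝔤` and `a ∈ ℝ` constant. -/
def spacetimeBracket (br : E →L[ℝ] E →L[ℝ] E) : E × ℝ →L[ℝ] E × ℝ →L[ℝ] E × ℝ :=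
  (ContinuousLinearMap.compL ℝ (E × ℝ) E (E × ℝ) (ContinuousLinearMap.inl ℝ E ℝ)).comp
    (br.bilinearComp (ContinuousLinearMap.fst ℝ E ℝ) (ContinuousLinearMap.fst ℝ E ℝ))

/-- The tensor `k = - γ' / 2`. -/
def secondForm (t₀ : ℝ) (γ : ℝ → Tensor2 E) (t : ℝ) : Tensor2 E :=
  -(1 / 2 : ℝ) • derivWithin γ (Ici t₀) t

/-- `H = - tr_γ k / n`. -/
def hubble (t₀ : ℝ) (γ : ℝ → Tensor2 E) (t : ℝ) : ℝ :=
  -metricTrace (γ t) (secondForm t₀ γ t) / (Module.finrank ℝ E : ℝ)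

/-- The shear tensor `σ = k + H γ`. -/
def shear (t₀ : ℝ) (γ : ℝ → Tensor2 E) (t : ℝ) : Tensor2 E :=
  secondForm t₀ γ t + hubble t₀ γ t • γ t

variable [FiniteDimensional ℝ E]

/-- The scalar curvature of the left-invariant Riemannian metric on `G` given by the inner product
`h` on the Lie algebra: no field acts on functions of time (`τ = 0`) and the metric is static. -/
def leftInvariantScalarCurvature (br : E →L[ℝ] E →L[ℝ] E) (h : Tensor2 E) : ℝ :=
  scalarCurvature br 0 univ (fun _ => h) 0

/-- The fields `γ, φ, ρ, j, S` on `I = [t₀, ∞)` have the required regularity and solve the coupled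
Einstein-scalar field-matter equations on `G × I`, where `br` is the bracket of the Lie algebra of
`G`. The scalar field takes its values in `J`, on which `V`, `C` and `c` live. -/
structure IsESMSolution (br : E →L[ℝ] E →L[ℝ] E) (J : Set ℝ) (V C c : ℝ → ℝ) (t₀ : ℝ)
    (γ : ℝ → Tensor2 E) (φ ρ : ℝ → ℝ) (j : ℝ → E →L[ℝ] ℝ) (S : ℝ → Tensor2 E) : Prop where
  contDiffOn_metric : ContDiffOn ℝ 2 γ (Ici t₀)
  riemannian : ∀ t ∈ Ici t₀, IsInnerProduct (γ t)
  contDiffOn_field : ContDiffOn ℝ 2 φ (Ici t₀)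
  mapsTo_field : MapsTo φ (Ici t₀) J
  contDiffOn_density : ContDiffOn ℝ 1 ρ (Ici t₀)
  contDiffOn_flow : ContDiffOn ℝ 1 j (Ici t₀)
  contDiffOn_pressure : ContDiffOn ℝ 1 S (Ici t₀)
  symm_pressure : ∀ t ∈ Ici t₀, ∀ x y, S t x y = S t y x
  /-- `Rc - R g / 2 = dφ ⊗ dφ - |dφ|² g / 2 - V(φ) g + C(φ) T` -/
  einstein : ∀ t ∈ Ici t₀,
    ricci (spacetimeBracket br) dt (Ici t₀) (spacetimeMetric γ) t
      - (1 / 2 * scalarCurvature (spacetimeBracket br) dt (Ici t₀) (spacetimeMetric γ) t) •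
        spacetimeMetric γ t
    = tensorProd (differential dt (Ici t₀) φ t) (differential dt (Ici t₀) φ t)
      - (1 / 2 * covectorInner (spacetimeMetric γ t) (differential dt (Ici t₀) φ t)
          (differential dt (Ici t₀) φ t)) • spacetimeMetric γ t
      - V (φ t) • spacetimeMetric γ t
      + C (φ t) • energyMomentum ρ j S t
  /-- `□φ - V'(φ) = - c(φ) tr T` -/
  scalar : ∀ t ∈ Ici t₀,
    box (spacetimeBracket br) dt (Ici t₀) (spacetimeMetric γ) φ t - derivWithin V J (φ t)
    = -(c (φ t) * metricTrace (spacetimeMetric γ t) (energyMomentum ρ j S t))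
  /-- `div (C(φ) T) = c(φ) (tr T) dφ` -/
  matter : ∀ t ∈ Ici t₀, ∀ Z : E × ℝ,
    divergence (spacetimeBracket br) dt (Ici t₀) (spacetimeMetric γ)
      (fun r => C (φ r) • energyMomentum ρ j S r) t Z
    = c (φ t) * metricTrace (spacetimeMetric γ t) (energyMomentum ρ j S t) *
        differential dt (Ici t₀) φ t Z

/-- The energy conditions on the matter variables. -/
structure EnergyConditions (t₀ : ℝ) (γ : ℝ → Tensor2 E) (ρ : ℝ → ℝ) (j : ℝ → E →L[ℝ] ℝ)
    (S : ℝ → Tensor2 E) : Prop where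
  dominant_flow : ∀ t ∈ Ici t₀, √(covectorInner (γ t) (j t) (j t)) ≤ ρ t
  dominant_pressure : ∀ t ∈ Ici t₀,
    |metricTrace (γ t) (S t)| ≤ (Module.finrank ℝ E : ℝ) * ρ t
  strong : ∀ t ∈ Ici t₀, 0 ≤ ρ t + metricTrace (γ t) (S t)

end SpaceTime

/-- The assumptions on the coupling functions on the interval `J`. -/
structure CouplingConditions (J : Set ℝ) (C c : ℝ → ℝ) : Prop where
  contDiffOn : ContDiffOn ℝ 1 C J
  continuousOn : ContinuousOn c J
  nonneg : ∀ x ∈ J, 0 ≤ C x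
  bound : ∃ C₀ : ℝ, ∀ x ∈ J, |c x| ≤ C₀ * C x

/-- The assumptions on the potential on the interval `J`. -/
structure PotentialConditions (J : Set ℝ) (V : ℝ → ℝ) : Prop where
  contDiffOn : ContDiffOn ℝ 1 V J
  pos : ∀ x ∈ J, 0 < V x
  /-- a positive lower semi-continuous minorant on the closure of `J` in `ℝ` -/
  minorant : ∃ W : ℝ → ℝ, LowerSemicontinuousOn W (closure J) ∧ (∀ x ∈ closure J, 0 < W x) ∧
    ∀ x ∈ J, W x ≤ V x
  /-- `V'` is bounded on the subsets on which `V` is bounded -/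
  deriv_bounded : ∀ K ⊆ J, Bornology.IsBounded (V '' K) →
    Bornology.IsBounded (derivWithin V J '' K)
  /-- `V'` extends continuously, with values in `[-∞, ∞]`, to the closure of `J` in `[-∞, ∞]` -/
  deriv_extends : ∃ F : EReal → EReal, ContinuousOn F (closure (Real.toEReal '' J)) ∧
    ∀ x ∈ J, F (x : EReal) = ((derivWithin V J x : ℝ) : EReal)

end Quintessence

end

/-! Write `ψ = φ'`. Everything is controlled by one energy, `Q = |σ|² - R_γ + 2 C(φ) ρ`. Its three
terms are non-negative, since left-invariant metrics have `R_γ ≤ 0` and `ρ ≥ 0` by the dominant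
condition. Each quantity of the conclusion is at most a constant times `Q`, so it suffices that `t²
Q` is bounded. The Hamiltonian constraint reads `Q = n(n-1)H² - ψ² - 2V(φ)`. With `V > 0` it
prevents `H` from vanishing, so `H` stays positive, and it gives `Q ≤ n(n-1)H²`. Differentiating its
right side along the evolution equations cancels both `V'` and `ψ²`, leaving `Q' ≤ -2HQ + c|ψ|Q` for
a constant `c`; the evolution of `H` also gives `H' ≤ -bψ²` with `b > 0`
(`IsESMSolution.isBigO_energy`). The coupling term `c|ψ|Q` need not be small compared with `HQ`. It
is absorbed by the weight `H^K`: in the derivative of `Q H^K` the decrease of `H` contributes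
`-Kbψ²`, which for large `K` dominates the cross term by completing a square, so that `(Q H^K)' ≤ -H
· Q H^K`. This yields the rate `t⁻²` without any lower bound on `H`
(`exists_sq_mul_le_of_deriv_le`). The remaining work derives these scalar equations from the
tensorial field equations, using the Weingarten map `N = ½ γ⁻¹ γ'`. -/

namespace Quintessence

/-! ### A decay estimate for a differential inequality -/

/-- If `f` cannot increase wherever it exceeds `M`, then it stays below `M`. -/
theorem le_of_deriv_nonpos_above {f f' : ℝ → ℝ} {a M : ℝ}
    (hf : ∀ t ∈ Ici a, HasDerivWithinAt f (f' t) (Ici a) t) (ha : f a ≤ M)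
    (hM : ∀ t ∈ Ici a, M < f t → f' t ≤ 0) {t : ℝ} (ht : t ∈ Ici a) : f t ≤ M := by
  -- The barrier has slope `ε > 0` and, thanks to the `+ 1`, lies strictly above `M` already at `a`.
  -- At a contact point `f` exceeds `M`, so its slope is at most `0 < ε`. Then `ε → 0`.
  have key : ∀ ε > 0, f t ≤ M + ε * (t - a + 1) := by
    intro ε hε
    refine image_le_of_deriv_right_lt_deriv_boundary (f := f) (f' := f') (a := a) (b := t)
      (B := fun x => M + ε * (x - a + 1)) (B' := fun _ => ε) ?_ ?_ ?_ ?_ ?_ ⟨ht, le_rfl⟩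
    · exact fun x hx => (hf x hx.1).continuousWithinAt.mono Icc_subset_Ici_self
    · exact fun x hx => (hf x hx.1).mono (Ici_subset_Ici.2 hx.1)
    · simp only [sub_self, zero_add, mul_one]; linarith
    · intro x
      simpa using ((((hasDerivAt_id x).sub_const a).add_const 1).const_mul ε).const_add M
    · intro x hx hfx
      have : 0 < ε * (x - a + 1) := mul_pos hε (by linarith [hx.1])
      exact (hM x hx.1 (by linarith)).trans_lt hε
  have hpos : 0 < t - a + 1 := by linarith [mem_Ici.1 ht]
  refine le_of_forall_pos_le_add fun δ hδ => ?_
  have := key (δ / (t - a + 1)) (by positivity)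
  rwa [div_mul_cancel₀ _ hpos.ne'] at this

/-- Let `H > 0` satisfy `H' ≤ -b ψ²` and let `0 ≤ Q ≤ m H²` satisfy `Q' ≤ -2 H Q + c |ψ| Q`.
Then `t² Q` is bounded. -/
theorem exists_sq_mul_le_of_deriv_le {H H' Q Q' ψ : ℝ → ℝ} {a b m c : ℝ} (ha : 0 < a) (hb : 0 < b)
    (hH : ∀ t ∈ Ici a, HasDerivWithinAt H (H' t) (Ici a) t)
    (hQ : ∀ t ∈ Ici a, HasDerivWithinAt Q (Q' t) (Ici a) t)
    (hpos : ∀ t ∈ Ici a, 0 < H t) (hQ0 : ∀ t ∈ Ici a, 0 ≤ Q t)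
    (hQm : ∀ t ∈ Ici a, Q t ≤ m * H t ^ 2)
    (hH' : ∀ t ∈ Ici a, H' t ≤ -b * ψ t ^ 2)
    (hQ' : ∀ t ∈ Ici a, Q' t ≤ -2 * H t * Q t + c * |ψ t| * Q t) :
    ∃ B, ∀ t ∈ Ici a, t ^ 2 * Q t ≤ B := by
  -- `c² ≤ 4bK` is the discriminant condition for `H² - c|ψ|H + Kbψ² ≥ 0`. A natural exponent keeps
  -- `H ^ K` an ordinary power.
  obtain ⟨K, hK⟩ := exists_nat_ge (c ^ 2 / (4 * b))
  have hK : c ^ 2 ≤ 4 * b * K := by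
    rw [div_le_iff₀ (by positivity)] at hK; linarith
  have hm : 0 ≤ m := by
    have h1 := (hQ0 a self_mem_Ici).trans (hQm a self_mem_Ici)
    have h2 := hpos a self_mem_Ici
    exact nonneg_of_mul_nonneg_left h1 (by positivity)
  set A : ℝ := K + 2 with hA
  have hA0 : 0 < A := by positivity
  -- `P` is invariant under the scaling `H ~ 1/t`, `Q ~ 1/t²`. Where `tH ≤ A` it is bounded by `Q ≤
  -- mH²`; where `tH > A` it is non-increasing.
  set P : ℝ → ℝ := fun t => t ^ (K + 2) * (Q t * H t ^ K) with hP
  have hlow : ∀ t ∈ Ici a, t * H t ≤ A → P t ≤ m * A ^ (K + 2) := by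
    intro t ht hA'
    have h0 : 0 < t := ha.trans_le ht
    have h1 := hpos t ht
    calc P t ≤ t ^ (K + 2) * (m * H t ^ 2 * H t ^ K) := by
          simp only [hP]; gcongr; exact hQm t ht
      _ = m * (t * H t) ^ (K + 2) := by ring
      _ ≤ _ := by gcongr
  set M := max (P a) (m * A ^ (K + 2)) with hM
  have hPM : ∀ t ∈ Ici a, P t ≤ M := by
    intro t ht
    refine le_of_deriv_nonpos_above (f := P) (a := a)
      (f' := fun t => ((K + 2 : ℕ) : ℝ) * t ^ (K + 2 - 1) * (Q t * H t ^ K)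
        + t ^ (K + 2) * (Q' t * H t ^ K + Q t * ((K : ℝ) * H t ^ (K - 1) * H' t)))
      (fun s hs => ?_) (le_max_left _ _) (fun s hs hlt => ?_) ht
    · exact ((hasDerivAt_pow (K + 2) s).hasDerivWithinAt).mul ((hQ s hs).mul ((hH s hs).pow K))
    · have h0 : 0 < s := ha.trans_le hs
      have h1 := hpos s hs
      have h2 : A < s * H s := by
        by_contra! h
        exact absurd (hlow s hs h) (not_le.2 ((le_max_right _ _).trans_lt hlt))
      -- The factor `K` makes this survive the truncated exponent at `K = 0`.
      have h3 : (K : ℝ) * H s ^ (K - 1) * H s = K * H s ^ K := by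
        rcases K with _ | K
        · simp
        · simp [pow_succ]; ring
      have h4 : H s * Q' s + Q s * K * H' s ≤ -H s * H s * Q s := by
        have e1 : H s * Q' s ≤ H s * (-2 * H s * Q s + c * |ψ s| * Q s) :=
          mul_le_mul_of_nonneg_left (hQ' s hs) h1.le
        have e2 : Q s * K * H' s ≤ Q s * K * (-b * ψ s ^ 2) :=
          mul_le_mul_of_nonneg_left (hH' s hs) (mul_nonneg (hQ0 s hs) (Nat.cast_nonneg K))
        have e3 : c * |ψ s| * H s ≤ H s ^ 2 + K * b * ψ s ^ 2 := by
          have := sq_nonneg (H s - c * |ψ s| / 2)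
          have h5 : c ^ 2 * ψ s ^ 2 ≤ 4 * b * K * ψ s ^ 2 := by gcongr
          have h6 := sq_abs (ψ s)
          have h7 : (H s - c * |ψ s| / 2) ^ 2
            = H s ^ 2 - c * |ψ s| * H s + c ^ 2 * ψ s ^ 2 / 4 := by rw [← h6]; ring
          linarith
        have e4 := mul_le_mul_of_nonneg_left e3 (hQ0 s hs)
        linarith
      -- Multiplying by `H s > 0` turns `H ^ (K - 1)` into `H ^ K`, so the sign can be read off a
      -- common factor.
      refine nonpos_of_mul_nonpos_left (b := H s) ?_ h1
      have h8 : (((K + 2 : ℕ) : ℝ) * s ^ (K + 2 - 1) * (Q s * H s ^ K)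
        + s ^ (K + 2) * (Q' s * H s ^ K + Q s * ((K : ℝ) * H s ^ (K - 1) * H' s))) * H s
        = s ^ (K + 1) * H s ^ K * (A * Q s * H s + s * (H s * Q' s + Q s * K * H' s)) := by
        have : s ^ (K + 2) * (Q' s * H s ^ K + Q s * ((K : ℝ) * H s ^ (K - 1) * H' s)) * H s
          = s ^ (K + 2) * (Q' s * H s ^ K * H s + Q s * ((K : ℝ) * H s ^ (K - 1) * H s) * H' s) := by
          ring
        rw [add_mul, this, h3, show K + 2 - 1 = K + 1 by omega, hA]
        push_cast
        ring
      rw [h8]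
      refine mul_nonpos_of_nonneg_of_nonpos (by positivity) ?_
      have e5 := mul_le_mul_of_nonneg_left h4 h0.le
      have e6 : 0 ≤ (s * H s - A) * (Q s * H s) :=
        mul_nonneg (by linarith) (mul_nonneg (hQ0 s hs) h1.le)
      linarith
  refine ⟨max (m * A ^ 2) (M / A ^ K), fun t ht => ?_⟩
  have h0 : 0 < t := ha.trans_le ht
  have h1 := hpos t ht
  -- For small `tH` the bound `Q ≤ mH²` is enough; for large `tH` the weight `(tH)^K` in `P` is at
  -- least `A^K` and can be divided out.
  rcases le_total (t * H t) A with h | h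
  · refine le_max_of_le_left ?_
    calc t ^ 2 * Q t ≤ t ^ 2 * (m * H t ^ 2) := by gcongr; exact hQm t ht
      _ = m * (t * H t) ^ 2 := by ring
      _ ≤ _ := by gcongr
  · refine le_max_of_le_right ?_
    rw [le_div_iff₀ (by positivity)]
    have h2 := hQ0 t ht
    calc t ^ 2 * Q t * A ^ K ≤ t ^ 2 * Q t * (t * H t) ^ K := by gcongr
      _ = P t := by simp only [hP]; ring
      _ ≤ M := hPM t ht

/-! ### Linear algebra -/

section LinearAlgebra

variable {A : Type*} [NormedAddCommGroup A] [NormedSpace ℝ A]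

/-- `ContinuousLinearMap.inverse` has the default value `0` on non-invertible maps, so an explicit
two-sided inverse is what gives access to `sharp`. -/
theorem sharp_eq_of_inverse {g : Tensor2 A} (S : (A →L[ℝ] ℝ) →L[ℝ] A)
    (h₁ : ∀ x, S (g x) = x) (h₂ : ∀ α, g (S α) = α) : sharp g = S :=
  ContinuousLinearMap.inverse_equiv (ContinuousLinearEquiv.equivOfInverse g S h₁ h₂)

theorem IsInnerProduct.injective {g : Tensor2 A} (hg : IsInnerProduct g) :
    Function.Injective g := by
  refine (injective_iff_map_eq_zero g).2 fun x hx => ?_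
  by_contra h
  have := hg.pos x h
  simp [hx] at this

theorem raise_add (g B D : Tensor2 A) : raise g (B + D) = raise g B + raise g D := by
  ext x; simp [raise]

theorem raise_smul (g B : Tensor2 A) (r : ℝ) : raise g (r • B) = r • raise g B := by
  ext x; simp [raise]

theorem metricTrace_add (g B D : Tensor2 A) :
    metricTrace g (B + D) = metricTrace g B + metricTrace g D := by
  simp [metricTrace, raise_add]

theorem metricTrace_smul (g B : Tensor2 A) (r : ℝ) :
    metricTrace g (r • B) = r * metricTrace g B := by
  simp [metricTrace, raise_smul]

theorem metricTrace_sub (g B D : Tensor2 A) :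
    metricTrace g (B - D) = metricTrace g B - metricTrace g D := by
  rw [show B - D = B + (-1 : ℝ) • D by module, metricTrace_add, metricTrace_smul]
  ring

variable [FiniteDimensional ℝ A]

theorem IsInnerProduct.exists_equiv {g : Tensor2 A} (hg : IsInnerProduct g) :
    ∃ e : A ≃L[ℝ] (A →L[ℝ] ℝ), (e : A →L[ℝ] A →L[ℝ] ℝ) = g := by
  have hdim : Module.finrank ℝ A = Module.finrank ℝ (A →L[ℝ] ℝ) := by
    rw [← (LinearMap.toContinuousLinearMap : (A →ₗ[ℝ] ℝ) ≃ₗ[ℝ] (A →L[ℝ] ℝ)).finrank_eq]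
    exact (Subspace.dual_finrank_eq (K := ℝ) (V := A)).symm
  refine ⟨(LinearMap.linearEquivOfInjective (g : A →ₗ[ℝ] A →L[ℝ] ℝ)
    hg.injective hdim).toContinuousLinearEquiv, ?_⟩
  ext x y
  rfl

theorem IsInnerProduct.sharp_apply {g : Tensor2 A} (hg : IsInnerProduct g) (x : A) :
    sharp g (g x) = x := by
  obtain ⟨e, rfl⟩ := hg.exists_equiv
  rw [sharp, ContinuousLinearMap.inverse_equiv]
  exact e.symm_apply_apply x

theorem IsInnerProduct.apply_sharp {g : Tensor2 A} (hg : IsInnerProduct g) (α : A →L[ℝ] ℝ) :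
    g (sharp g α) = α := by
  obtain ⟨e, rfl⟩ := hg.exists_equiv
  rw [sharp, ContinuousLinearMap.inverse_equiv]
  exact e.apply_symm_apply α

theorem IsInnerProduct.apply_raise {g : Tensor2 A} (hg : IsInnerProduct g) (B : Tensor2 A)
    (x : A) : g (raise g B x) = B x := hg.apply_sharp (B x)

theorem IsInnerProduct.raise_self {g : Tensor2 A} (hg : IsInnerProduct g) :
    raise g g = ContinuousLinearMap.id ℝ A := by
  ext x; exact hg.sharp_apply x

/-- The square of an endomorphism that is self-adjoint for an inner product has trace `≥ 0`. -/
theorem IsInnerProduct.trace_sq_nonneg {g : Tensor2 A} (hg : IsInnerProduct g) (L : A →ₗ[ℝ] A)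
    (hL : ∀ x y, g (L x) y = g x (L y)) : 0 ≤ LinearMap.trace ℝ A (L ∘ₗ L) := by
  let B : LinearMap.BilinForm ℝ A := LinearMap.mk₂ ℝ (fun x y => g x y) (by simp) (by simp)
    (by simp) (by simp)
  have hB : LinearMap.IsSymm B := ⟨fun x y => hg.symm x y⟩
  -- No normalisation is needed: the diagonal entries of `L²` are `g(L vᵢ, L vᵢ) / g(vᵢ, vᵢ)`.
  obtain ⟨v, hv⟩ := LinearMap.BilinForm.exists_orthogonal_basis hB
  have hpos : ∀ i, 0 < g (v i) (v i) := fun i => hg.pos _ (v.ne_zero i)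
  have hrepr : ∀ i w, v.repr w i = g (v i) w / g (v i) (v i) := by
    intro i w
    rw [eq_div_iff (hpos i).ne']
    conv_rhs => rw [← v.sum_repr w]
    rw [map_sum, Finset.sum_eq_single i]
    · simp
    · intro k _ hk
      have : g (v i) (v k) = 0 := hv hk.symm
      simp [this]
    · simp
  rw [LinearMap.trace_eq_matrix_trace ℝ v, Matrix.trace]
  refine Finset.sum_nonneg fun i _ => ?_
  rw [Matrix.diag_apply, LinearMap.toMatrix_apply, hrepr, LinearMap.comp_apply, ← hL]
  refine div_nonneg ?_ (hpos i).le
  by_cases h : L (v i) = 0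
  · simp [h]
  · exact (hg.pos _ h).le

end LinearAlgebra

/-! ### The space-time metric -/

section Product

variable {E : Type*} [NormedAddCommGroup E] [NormedSpace ℝ E]

@[simp] theorem dt_apply (X : E × ℝ) : dt X = X.2 := rfl

@[simp] theorem pullTensor_apply (B : Tensor2 E) (X Y : E × ℝ) :
    pullTensor B X Y = B X.1 Y.1 := rfl

@[simp] theorem pullForm_apply (α : E →L[ℝ] ℝ) (X : E × ℝ) : pullForm α X = α X.1 := rfl

@[simp] theorem tensorProd_apply (α β : E →L[ℝ] ℝ) (x y : E) :
    tensorProd α β x y = α x * β y := by simp [tensorProd]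

@[simp] theorem spacetimeMetric_apply (γ : ℝ → Tensor2 E) (t : ℝ) (X Y : E × ℝ) :
    spacetimeMetric γ t X Y = γ t X.1 Y.1 - X.2 * Y.2 := by
  simp [spacetimeMetric]

@[simp] theorem spacetimeBracket_apply (br : E →L[ℝ] E →L[ℝ] E) (X Y : E × ℝ) :
    spacetimeBracket br X Y = (br X.1 Y.1, 0) := rfl

@[simp] theorem energyMomentum_apply (ρ : ℝ → ℝ) (j : ℝ → E →L[ℝ] ℝ) (S : ℝ → Tensor2 E) (t : ℝ)
    (X Y : E × ℝ) : energyMomentum ρ j S t X Y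
      = S t X.1 Y.1 - j t X.1 * Y.2 - X.2 * j t Y.1 + ρ t * (X.2 * Y.2) := by
  simp [energyMomentum]

variable [FiniteDimensional ℝ E]

theorem trace_prod_real (L : E × ℝ →ₗ[ℝ] E × ℝ) :
    LinearMap.trace ℝ (E × ℝ) L
      = LinearMap.trace ℝ E (LinearMap.fst ℝ E ℝ ∘ₗ L ∘ₗ LinearMap.inl ℝ E ℝ) + (L (0, 1)).2 := by
  -- Cyclicity of the trace turns each summand into the trace of a diagonal block.
  have h : L = (L ∘ₗ LinearMap.inl ℝ E ℝ) ∘ₗ LinearMap.fst ℝ E ℝ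
      + (L ∘ₗ LinearMap.inr ℝ E ℝ) ∘ₗ LinearMap.snd ℝ E ℝ := by
    refine LinearMap.ext fun x => ?_
    simp [← map_add]
  conv_lhs => rw [h]
  rw [map_add, LinearMap.trace_comp_comm', LinearMap.trace_comp_comm' (LinearMap.snd ℝ E ℝ)]
  congr 1
  rw [LinearMap.trace_eq_matrix_trace ℝ (Module.Basis.singleton Unit ℝ)]
  simp [Matrix.trace, LinearMap.toMatrix_apply]

theorem sharp_spacetimeMetric {γ : ℝ → Tensor2 E} {t : ℝ} (hγ : IsInnerProduct (γ t))
    (α : E × ℝ →L[ℝ] ℝ) : sharp (spacetimeMetric γ t) α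
      = (sharp (γ t) (α.comp (ContinuousLinearMap.inl ℝ E ℝ)), -α (0, 1)) := by
  let T : (E × ℝ →L[ℝ] ℝ) →ₗ[ℝ] E × ℝ :=
    { toFun := fun α => (sharp (γ t) (α.comp (ContinuousLinearMap.inl ℝ E ℝ)), -α (0, 1))
      map_add' := fun α β => by simp [ContinuousLinearMap.add_comp]; ring
      map_smul' := fun r α => by simp [ContinuousLinearMap.smul_comp] }
  rw [sharp_eq_of_inverse (g := spacetimeMetric γ t) T.toContinuousLinearMap]
  · rfl
  · rintro ⟨x, a⟩
    have : (spacetimeMetric γ t (x, a)).comp (ContinuousLinearMap.inl ℝ E ℝ) = γ t x := by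
      ext y; simp
    simp [T, this, hγ.sharp_apply]
  · intro α
    refine ContinuousLinearMap.ext fun X => ?_
    have : X = ContinuousLinearMap.inl ℝ E ℝ X.1 + X.2 • ((0, 1) : E × ℝ) := by
      ext <;> simp
    conv_rhs => rw [this, map_add, map_smul]
    simp [T, hγ.apply_sharp]
    ring

theorem metricTrace_spacetimeMetric {γ : ℝ → Tensor2 E} {t : ℝ} (hγ : IsInnerProduct (γ t))
    (B : Tensor2 (E × ℝ)) : metricTrace (spacetimeMetric γ t) B
      = metricTrace (γ t) (B.bilinearComp (ContinuousLinearMap.inl ℝ E ℝ)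
          (ContinuousLinearMap.inl ℝ E ℝ)) - B (0, 1) (0, 1) := by
  rw [metricTrace, trace_prod_real, metricTrace, sub_eq_add_neg]
  congr 1
  · congr 1
    refine LinearMap.ext fun x => ?_
    simp only [raise, LinearMap.comp_apply, ContinuousLinearMap.coe_coe,
      ContinuousLinearMap.comp_apply, sharp_spacetimeMetric hγ]
    rfl
  · simp only [raise, ContinuousLinearMap.coe_coe,
      ContinuousLinearMap.comp_apply, sharp_spacetimeMetric hγ]

end Product

/-! ### Regularity of the metric and of its Weingarten map -/

section Geometry

variable {E : Type*} [NormedAddCommGroup E] [NormedSpace ℝ E] {t₀ : ℝ} {γ : ℝ → Tensor2 E}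

/-- The Weingarten map `½ γ⁻¹ γ'` of the slices `G × {t}` with respect to `∂_t`. -/
noncomputable def weingarten (t₀ : ℝ) (γ : ℝ → Tensor2 E) (t : ℝ) : E →L[ℝ] E :=
  (1 / 2 : ℝ) • raise (γ t) (derivWithin γ (Ici t₀) t)

theorem raise_derivWithin (t : ℝ) :
    raise (γ t) (derivWithin γ (Ici t₀) t) = (2 : ℝ) • weingarten t₀ γ t := by
  simp [weingarten, smul_smul]

theorem contDiffOn_derivWithin_metric (hγ : ContDiffOn ℝ 2 γ (Ici t₀)) :
    ContDiffOn ℝ 1 (derivWithin γ (Ici t₀)) (Ici t₀) :=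
  hγ.derivWithin (uniqueDiffOn_Ici t₀) (by norm_num)

theorem derivWithin_metric_symm (hγ : ContDiffOn ℝ 2 γ (Ici t₀))
    (hp : ∀ t ∈ Ici t₀, IsInnerProduct (γ t)) {t : ℝ} (ht : t ∈ Ici t₀) (x y : E) :
    derivWithin γ (Ici t₀) t x y = derivWithin γ (Ici t₀) t y x := by
  have h := (hγ.differentiableOn (by norm_num) t ht).hasDerivWithinAt
  have h1 : ∀ x y : E, HasDerivWithinAt (fun r => γ r x y) (derivWithin γ (Ici t₀) t x y)
      (Ici t₀) t := fun x y => by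
    simpa using (h.clm_apply (hasDerivWithinAt_const t (Ici t₀) x)).clm_apply
      (hasDerivWithinAt_const t (Ici t₀) y)
  exact (uniqueDiffOn_Ici t₀ t ht).eq_deriv _ (h1 x y)
    ((h1 y x).congr (fun r hr => (hp r hr).symm x y) ((hp t ht).symm x y))

variable [FiniteDimensional ℝ E]

theorem contDiffOn_sharp (hγ : ContDiffOn ℝ 2 γ (Ici t₀))
    (hp : ∀ t ∈ Ici t₀, IsInnerProduct (γ t)) :
    ContDiffOn ℝ 2 (fun t => sharp (γ t)) (Ici t₀) := by
  have : CompleteSpace E := FiniteDimensional.complete ℝ E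
  intro t ht
  obtain ⟨e, he⟩ := (hp t ht).exists_equiv
  have := contDiffAt_map_inverse (𝕜 := ℝ) (n := 2) e
  rw [he] at this
  exact this.comp_contDiffWithinAt t (hγ t ht)

theorem contDiffOn_weingarten (hγ : ContDiffOn ℝ 2 γ (Ici t₀))
    (hp : ∀ t ∈ Ici t₀, IsInnerProduct (γ t)) :
    ContDiffOn ℝ 1 (weingarten t₀ γ) (Ici t₀) :=
  (((contDiffOn_sharp hγ hp).of_le (by norm_num)).clm_comp
    (contDiffOn_derivWithin_metric hγ)).const_smul _

theorem metric_weingarten {t : ℝ} (hp : IsInnerProduct (γ t)) (x : E) :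
    γ t (weingarten t₀ γ t x) = (1 / 2 : ℝ) • derivWithin γ (Ici t₀) t x := by
  simp [weingarten, hp.apply_raise]

/-- `½ γ⁻¹ γ'' = N' + 2 N²` for the Weingarten map `N`. -/
theorem raise_derivWithin_derivWithin (hγ : ContDiffOn ℝ 2 γ (Ici t₀))
    (hp : ∀ t ∈ Ici t₀, IsInnerProduct (γ t)) {t : ℝ} (ht : t ∈ Ici t₀) :
    (1 / 2 : ℝ) • raise (γ t) (derivWithin (derivWithin γ (Ici t₀)) (Ici t₀) t)
      = derivWithin (weingarten t₀ γ) (Ici t₀) t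
        + (2 : ℝ) • (weingarten t₀ γ t).comp (weingarten t₀ γ t) := by
  ext x
  have h1 := (hγ.differentiableOn (by norm_num) t ht).hasDerivWithinAt
  have h2 := ((contDiffOn_derivWithin_metric hγ).differentiableOn (by norm_num) t
    ht).hasDerivWithinAt
  have h3 := ((contDiffOn_weingarten hγ hp).differentiableOn (by norm_num) t ht).hasDerivWithinAt
  have hx := hasDerivWithinAt_const t (Ici t₀) x
  -- Differentiating `γ N = ½ γ'` gives `γ' N + γ N' = ½ γ''`, and `γ' = 2 γ N`.
  have h4 := h1.clm_apply (h3.clm_apply hx)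
  have h5 := ((h2.clm_apply hx).const_smul (1 / 2 : ℝ)).congr
    (fun r hr => metric_weingarten (t₀ := t₀) (hp r hr) x) (metric_weingarten (hp t ht) x)
  have h6 := (uniqueDiffOn_Ici t₀ t ht).eq_deriv _ h4 h5
  simp only [map_zero, add_zero] at h6
  apply (hp t ht).injective
  simp only [map_add, map_smul, add_apply, smul_apply, ContinuousLinearMap.comp_apply,
    (hp t ht).apply_raise, ← h6, metric_weingarten (hp t ht), smul_smul]
  rw [add_comm]
  norm_num

theorem weingarten_symm (hγ : ContDiffOn ℝ 2 γ (Ici t₀))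
    (hp : ∀ t ∈ Ici t₀, IsInnerProduct (γ t)) {t : ℝ} (ht : t ∈ Ici t₀) (x y : E) :
    γ t (weingarten t₀ γ t x) y = γ t x (weingarten t₀ γ t y) := by
  rw [(hp t ht).symm x, metric_weingarten (hp t ht), metric_weingarten (hp t ht), smul_apply,
    smul_apply, derivWithin_metric_symm hγ hp ht]

/-! ### The Levi-Civita connection of the space-time -/

/-- The Christoffel map of the left-invariant metric `γ t` on `G`. -/
noncomputable abbrev spaceChristoffel (br : E →L[ℝ] E →L[ℝ] E) (h : Tensor2 E) :
    E →L[ℝ] E →L[ℝ] E := christoffel br 0 univ (fun _ => h) 0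

theorem derivWithin_spacetimeMetric (hγ : ContDiffOn ℝ 2 γ (Ici t₀)) {t : ℝ} (ht : t ∈ Ici t₀)
    (X Y : E × ℝ) : derivWithin (spacetimeMetric γ) (Ici t₀) t X Y
      = derivWithin γ (Ici t₀) t X.1 Y.1 := by
  have h0 : ContDiffOn ℝ 1 (spacetimeMetric γ) (Ici t₀) := by
    refine contDiffOn_clm_apply.2 fun X => contDiffOn_clm_apply.2 fun Y => ?_
    simp only [spacetimeMetric_apply]
    exact (((hγ.of_le (by norm_num)).clm_apply contDiffOn_const).clm_apply contDiffOn_const).sub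
      contDiffOn_const
  have h1 := (h0.differentiableOn (by norm_num) t ht).hasDerivWithinAt
  have h2 := (hγ.differentiableOn (by norm_num) t ht).hasDerivWithinAt
  have h3 := (h1.clm_apply (hasDerivWithinAt_const t (Ici t₀) X)).clm_apply
    (hasDerivWithinAt_const t (Ici t₀) Y)
  have h4 := (((h2.clm_apply (hasDerivWithinAt_const t (Ici t₀) X.1)).clm_apply
    (hasDerivWithinAt_const t (Ici t₀) Y.1)).sub_const (X.2 * Y.2)).congr
    (fun r _ => spacetimeMetric_apply γ r X Y) (spacetimeMetric_apply γ t X Y)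
  simpa using (uniqueDiffOn_Ici t₀ t ht).eq_deriv _ h3 h4

theorem christoffel_spacetime (br : E →L[ℝ] E →L[ℝ] E) (hγ : ContDiffOn ℝ 2 γ (Ici t₀))
    (hp : ∀ t ∈ Ici t₀, IsInnerProduct (γ t)) {t : ℝ} (ht : t ∈ Ici t₀) (X Y : E × ℝ) :
    christoffel (spacetimeBracket br) dt (Ici t₀) (spacetimeMetric γ) t X Y
      = (spaceChristoffel br (γ t) X.1 Y.1 + Y.2 • weingarten t₀ γ t X.1
          + X.2 • weingarten t₀ γ t Y.1, 1 / 2 * derivWithin γ (Ici t₀) t X.1 Y.1) := by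
  change sharp (spacetimeMetric γ t) (koszul _ _ _ _ _ _ _) = _
  rw [sharp_spacetimeMetric (hp t ht)]
  refine Prod.ext ?_ ?_
  · change sharp (γ t) _ = sharp (γ t) (koszul _ _ _ _ _ _ _) + _ + _
    apply (hp t ht).injective
    simp only [map_add, map_smul, (hp t ht).apply_sharp, metric_weingarten (hp t ht)]
    ext z
    simp [koszul, derivWithin_spacetimeMetric hγ ht]
    ring
  · simp [koszul, derivWithin_spacetimeMetric hγ ht]

/-- For each frozen metric `γ t` the choice `τ = 0` kills the derivative terms of Koszul's formula,
so the dependence on `t` is algebraic in `γ t` and its inverse. -/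
theorem contDiffOn_spaceChristoffel (br : E →L[ℝ] E →L[ℝ] E) (hγ : ContDiffOn ℝ 2 γ (Ici t₀))
    (hp : ∀ t ∈ Ici t₀, IsInnerProduct (γ t)) (x y : E) :
    ContDiffOn ℝ 1 (fun t => spaceChristoffel br (γ t) x y) (Ici t₀) := by
  change ContDiffOn ℝ 1 (fun t => sharp (γ t) (koszul br 0 univ (fun _ => γ t) 0 x y)) _
  have hγ1 : ContDiffOn ℝ 1 γ (Ici t₀) := hγ.of_le (by norm_num)
  refine ((contDiffOn_sharp hγ hp).of_le (by norm_num)).clm_apply ?_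
  simp only [koszul, zero_apply, zero_smul, smul_zero, add_zero, sub_self,
    zero_add]
  refine ContDiffOn.const_smul _ (((hγ1.clm_apply contDiffOn_const).sub ?_).sub ?_)
  · exact (hγ1.clm_apply contDiffOn_const).clm_comp contDiffOn_const
  · exact (hγ1.clm_apply contDiffOn_const).clm_comp contDiffOn_const

theorem contDiffOn_christoffel (br : E →L[ℝ] E →L[ℝ] E) (hγ : ContDiffOn ℝ 2 γ (Ici t₀))
    (hp : ∀ t ∈ Ici t₀, IsInnerProduct (γ t)) :
    ContDiffOn ℝ 1 (christoffel (spacetimeBracket br) dt (Ici t₀) (spacetimeMetric γ))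
      (Ici t₀) := by
  refine contDiffOn_clm_apply.2 fun X => contDiffOn_clm_apply.2 fun Y => ?_
  refine ContDiffOn.congr ?_ fun t ht => christoffel_spacetime br hγ hp ht X Y
  have hN := contDiffOn_weingarten hγ hp
  have hd := contDiffOn_derivWithin_metric hγ
  refine ContDiffOn.prodMk (((contDiffOn_spaceChristoffel br hγ hp _ _).add ?_).add ?_) ?_
  · exact (hN.clm_apply contDiffOn_const).const_smul _
  · exact (hN.clm_apply contDiffOn_const).const_smul _
  · exact contDiffOn_const.mul ((hd.clm_apply contDiffOn_const).clm_apply contDiffOn_const)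

theorem derivWithin_christoffel (br : E →L[ℝ] E →L[ℝ] E) (hγ : ContDiffOn ℝ 2 γ (Ici t₀))
    (hp : ∀ t ∈ Ici t₀, IsInnerProduct (γ t)) {t : ℝ} (ht : t ∈ Ici t₀) (X Y : E × ℝ) :
    derivWithin (christoffel (spacetimeBracket br) dt (Ici t₀) (spacetimeMetric γ)) (Ici t₀) t X Y
      = (derivWithin (fun r => spaceChristoffel br (γ r) X.1 Y.1) (Ici t₀) t
          + Y.2 • derivWithin (weingarten t₀ γ) (Ici t₀) t X.1
          + X.2 • derivWithin (weingarten t₀ γ) (Ici t₀) t Y.1,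
        1 / 2 * derivWithin (derivWithin γ (Ici t₀)) (Ici t₀) t X.1 Y.1) := by
  have hu := uniqueDiffOn_Ici t₀ t ht
  have h0 := ((contDiffOn_christoffel br hγ hp).differentiableOn
    (by norm_num) t ht).hasDerivWithinAt
  have h1 := ((contDiffOn_weingarten hγ hp).differentiableOn (by norm_num) t ht).hasDerivWithinAt
  have h2 := ((contDiffOn_derivWithin_metric hγ).differentiableOn (by norm_num) t
    ht).hasDerivWithinAt
  have h3 := ((contDiffOn_spaceChristoffel br hγ hp X.1 Y.1).differentiableOn (by norm_num) t
    ht).hasDerivWithinAt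
  have h4 := (h0.clm_apply (hasDerivWithinAt_const t (Ici t₀) X)).clm_apply (hasDerivWithinAt_const t (Ici t₀) Y)
  have h5 := (((h3.add ((h1.clm_apply (hasDerivWithinAt_const t (Ici t₀) X.1)).const_smul Y.2)).add
    ((h1.clm_apply (hasDerivWithinAt_const t (Ici t₀) Y.1)).const_smul X.2)).prodMk
    (((h2.clm_apply (hasDerivWithinAt_const t (Ici t₀) X.1)).clm_apply
      (hasDerivWithinAt_const t (Ici t₀) Y.1)).const_mul (1 / 2 : ℝ))).congr
    (fun r hr => christoffel_spacetime br hγ hp hr X Y) (christoffel_spacetime br hγ hp ht X Y)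
  simpa using hu.eq_deriv _ h4 h5

end Geometry

section Curvature

variable {E : Type*} [NormedAddCommGroup E] [NormedSpace ℝ E] [FiniteDimensional ℝ E]
  {t₀ : ℝ} {γ : ℝ → Tensor2 E}

/-! ### Curvature of the space-time -/

/-- Names the endomorphism inside `ricci`, so that `trace_prod_real` can split it into blocks. -/
theorem ricci_eq_trace {A : Type*} [NormedAddCommGroup A] [NormedSpace ℝ A]
    [FiniteDimensional ℝ A] (br : A →L[ℝ] A →L[ℝ] A) (τ : A →L[ℝ] ℝ) (s : Set ℝ)
    (g : ℝ → Tensor2 A) (t : ℝ) (Y Z : A) :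
    ∃ L : A →ₗ[ℝ] A, (∀ X, L X = riemann br τ s g t X Y Z) ∧
      ricci br τ s g t Y Z = LinearMap.trace ℝ A L :=
  ⟨_, fun _ => rfl, rfl⟩

/-- Raychaudhuri's equation: `Rc(∂_t, ∂_t) = - tr N' - tr N²`. -/
theorem ricci_time_time (br : E →L[ℝ] E →L[ℝ] E) (hγ : ContDiffOn ℝ 2 γ (Ici t₀))
    (hp : ∀ t ∈ Ici t₀, IsInnerProduct (γ t)) {t : ℝ} (ht : t ∈ Ici t₀) :
    ricci (spacetimeBracket br) dt (Ici t₀) (spacetimeMetric γ) t (0, 1) (0, 1)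
      = -LinearMap.trace ℝ E
            (derivWithin (weingarten t₀ γ) (Ici t₀) t : E →L[ℝ] E)
        - LinearMap.trace ℝ E ((weingarten t₀ γ t).comp (weingarten t₀ γ t)) := by
  obtain ⟨L, hL, h⟩ := ricci_eq_trace (spacetimeBracket br) dt (Ici t₀) (spacetimeMetric γ) t
    (0, 1) (0, 1)
  have h1 : LinearMap.fst ℝ E ℝ ∘ₗ L ∘ₗ LinearMap.inl ℝ E ℝ
      = -((derivWithin (weingarten t₀ γ) (Ici t₀) t : E →L[ℝ] E) : E →ₗ[ℝ] E)
        - ((weingarten t₀ γ t).comp (weingarten t₀ γ t) : E →ₗ[ℝ] E) := by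
    refine LinearMap.ext fun x => ?_
    simp [hL, riemann, christoffel_spacetime br hγ hp ht, derivWithin_christoffel br hγ hp ht]
    abel
  have h2 : (L (0, 1)).2 = 0 := by
    simp [hL, riemann, christoffel_spacetime br hγ hp ht, derivWithin_christoffel br hγ hp ht]
  rw [h, trace_prod_real, h1, h2, add_zero, map_sub, map_neg]

/-- The Gauss equation for the Ricci tensor in spatial directions. -/
theorem ricci_space_space (br : E →L[ℝ] E →L[ℝ] E) (hγ : ContDiffOn ℝ 2 γ (Ici t₀))
    (hp : ∀ t ∈ Ici t₀, IsInnerProduct (γ t)) {t : ℝ} (ht : t ∈ Ici t₀) (y z : E) :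
    ricci (spacetimeBracket br) dt (Ici t₀) (spacetimeMetric γ) t (y, 0) (z, 0)
      = ricci br 0 univ (fun _ => γ t) 0 y z
        + LinearMap.trace ℝ E (weingarten t₀ γ t) * (1 / 2 * derivWithin γ (Ici t₀) t y z)
        - derivWithin γ (Ici t₀) t (weingarten t₀ γ t y) z
        + 1 / 2 * derivWithin (derivWithin γ (Ici t₀)) (Ici t₀) t y z := by
  obtain ⟨L, hL, h⟩ := ricci_eq_trace (spacetimeBracket br) dt (Ici t₀) (spacetimeMetric γ) t
    (y, 0) (z, 0)
  obtain ⟨L', hL', h'⟩ := ricci_eq_trace br 0 univ (fun _ => γ t) 0 y z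
  -- The Gauss equation: intrinsic curvature plus terms quadratic in `N`. The last term has rank
  -- one, so its trace is an evaluation.
  have h1 : LinearMap.fst ℝ E ℝ ∘ₗ L ∘ₗ LinearMap.inl ℝ E ℝ
      = L' + (1 / 2 * derivWithin γ (Ici t₀) t y z) • (weingarten t₀ γ t : E →ₗ[ℝ] E)
        - ((1 / 2 : ℝ) • derivWithin γ (Ici t₀) t z).toLinearMap.smulRight
            (weingarten t₀ γ t y) := by
    refine LinearMap.ext fun x => ?_
    simp [hL, hL', riemann, christoffel_spacetime br hγ hp ht, derivWithin_christoffel br hγ hp ht,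
      derivWithin_metric_symm hγ hp ht z x]
    abel
  have h3 : derivWithin γ (Ici t₀) t y (weingarten t₀ γ t z)
      = derivWithin γ (Ici t₀) t (weingarten t₀ γ t y) z := by
    have e : ∀ x, derivWithin γ (Ici t₀) t x = (2 : ℝ) • γ t (weingarten t₀ γ t x) := fun x => by
      rw [metric_weingarten (hp t ht), smul_smul]; norm_num
    rw [e, e, smul_apply, smul_apply, weingarten_symm hγ hp ht (weingarten t₀ γ t y)]
  have h2 : (L (0, 1)).2 = 1 / 2 * derivWithin (derivWithin γ (Ici t₀)) (Ici t₀) t y z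
      - 1 / 2 * derivWithin γ (Ici t₀) t (weingarten t₀ γ t y) z := by
    simp [hL, riemann, christoffel_spacetime br hγ hp ht, derivWithin_christoffel br hγ hp ht, h3]
  rw [h, h', trace_prod_real, h1, h2, map_sub, map_add, map_smul, LinearMap.trace_smulRight]
  simp [derivWithin_metric_symm hγ hp ht z]
  ring

/-- The scalar curvature of the space-time, `R_γ + θ² + 2 θ' + tr N²` with `θ = tr N`. -/
theorem scalarCurvature_spacetime (br : E →L[ℝ] E →L[ℝ] E) (hγ : ContDiffOn ℝ 2 γ (Ici t₀))
    (hp : ∀ t ∈ Ici t₀, IsInnerProduct (γ t)) {t : ℝ} (ht : t ∈ Ici t₀) :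
    scalarCurvature (spacetimeBracket br) dt (Ici t₀) (spacetimeMetric γ) t
      = leftInvariantScalarCurvature br (γ t) + LinearMap.trace ℝ E (weingarten t₀ γ t) ^ 2
        + 2 * LinearMap.trace ℝ E
            (derivWithin (weingarten t₀ γ) (Ici t₀) t : E →L[ℝ] E)
        + LinearMap.trace ℝ E ((weingarten t₀ γ t).comp (weingarten t₀ γ t)) := by
  -- The `-2N²` of the Gauss equation cancels the `2N²` in `½ γ⁻¹ γ'' = N' + 2N²`.
  have h : raise (γ t) ((ricci (spacetimeBracket br) dt (Ici t₀) (spacetimeMetric γ) t).bilinearComp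
      (ContinuousLinearMap.inl ℝ E ℝ) (ContinuousLinearMap.inl ℝ E ℝ))
      = raise (γ t) (ricci br 0 univ (fun _ => γ t) 0)
        + LinearMap.trace ℝ E (weingarten t₀ γ t) • weingarten t₀ γ t
        + derivWithin (weingarten t₀ γ) (Ici t₀) t := by
    have hr := raise_derivWithin_derivWithin hγ hp ht
    refine ContinuousLinearMap.ext fun y => (hp t ht).injective ?_
    have hr' := congrArg (γ t) (DFunLike.congr_fun hr y)
    simp only [map_add, map_smul, add_apply, smul_apply, ContinuousLinearMap.comp_apply,
      (hp t ht).apply_raise, metric_weingarten (hp t ht), smul_smul] at hr' ⊢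
    ext z
    have hz := DFunLike.congr_fun hr' z
    have := ricci_space_space br hγ hp ht y z
    simp [ContinuousLinearMap.bilinearComp_apply] at this hz ⊢
    linarith
  rw [scalarCurvature, metricTrace_spacetimeMetric (hp t ht), ricci_time_time br hγ hp ht,
    metricTrace, h, leftInvariantScalarCurvature, scalarCurvature, metricTrace]
  simp
  ring

/-- `□φ = - φ'' - θ φ'`. -/
theorem box_spacetime (br : E →L[ℝ] E →L[ℝ] E) (hγ : ContDiffOn ℝ 2 γ (Ici t₀))
    (hp : ∀ t ∈ Ici t₀, IsInnerProduct (γ t)) {φ : ℝ → ℝ} (hφ : ContDiffOn ℝ 2 φ (Ici t₀))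
    {t : ℝ} (ht : t ∈ Ici t₀) :
    box (spacetimeBracket br) dt (Ici t₀) (spacetimeMetric γ) φ t
      = -derivWithin (derivWithin φ (Ici t₀)) (Ici t₀) t
        - LinearMap.trace ℝ E (weingarten t₀ γ t) * derivWithin φ (Ici t₀) t := by
  have hd : ContDiffOn ℝ 1 (derivWithin φ (Ici t₀)) (Ici t₀) :=
    hφ.derivWithin (uniqueDiffOn_Ici t₀) (by norm_num)
  have h1 : derivWithin (differential (A := E × ℝ) dt (Ici t₀) φ) (Ici t₀) t
      = derivWithin (derivWithin φ (Ici t₀)) (Ici t₀) t • dt :=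
    ((hd.differentiableOn (by norm_num) t ht).hasDerivWithinAt.smul_const
      (dt (E := E))).derivWithin
      (uniqueDiffOn_Ici t₀ t ht)
  set D := covDerivForm (spacetimeBracket br) dt (Ici t₀) (spacetimeMetric γ)
    (differential dt (Ici t₀) φ) t with hD
  have h2 : ∀ X Y, D X Y = X.2 * (derivWithin (derivWithin φ (Ici t₀)) (Ici t₀) t * Y.2)
      - derivWithin φ (Ici t₀) t * (1 / 2 * derivWithin γ (Ici t₀) t X.1 Y.1) := by
    intro X Y
    change dt X * derivWithin (differential dt (Ici t₀) φ) (Ici t₀) t Y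
      - differential dt (Ici t₀) φ t (christoffel _ _ _ _ t X Y) = _
    rw [h1, christoffel_spacetime br hγ hp ht]
    simp [differential]
  have h3 : D.bilinearComp (ContinuousLinearMap.inl ℝ E ℝ) (ContinuousLinearMap.inl ℝ E ℝ)
      = (-(1 / 2) * derivWithin φ (Ici t₀) t) • derivWithin γ (Ici t₀) t := by
    ext x y
    simp [h2]
    ring
  rw [box, metricTrace_spacetimeMetric (hp t ht), h3, metricTrace_smul, metricTrace,
    raise_derivWithin, h2]
  simp
  ring

end Curvature

section FieldEquations

variable {E : Type*} [NormedAddCommGroup E] [NormedSpace ℝ E]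
  {t₀ : ℝ} {γ : ℝ → Tensor2 E}

/-! ### Mean curvature and shear -/

theorem hubble_eq (t : ℝ) : hubble t₀ γ t
    = LinearMap.trace ℝ E (weingarten t₀ γ t) / Module.finrank ℝ E := by
  rw [hubble, secondForm, metricTrace_smul, metricTrace, raise_derivWithin]
  simp

theorem flip_shear (hγ : ContDiffOn ℝ 2 γ (Ici t₀))
    (hp : ∀ t ∈ Ici t₀, IsInnerProduct (γ t)) {t : ℝ} (ht : t ∈ Ici t₀) :
    (shear t₀ γ t).flip = shear t₀ γ t := by
  ext x y
  simp [shear, secondForm, derivWithin_metric_symm hγ hp ht x y, (hp t ht).symm x y]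

variable [FiniteDimensional ℝ E]

theorem hasDerivWithinAt_hubble (hγ : ContDiffOn ℝ 2 γ (Ici t₀))
    (hp : ∀ t ∈ Ici t₀, IsInnerProduct (γ t)) {t : ℝ} (ht : t ∈ Ici t₀) :
    HasDerivWithinAt (hubble t₀ γ) (LinearMap.trace ℝ E
      (derivWithin (weingarten t₀ γ) (Ici t₀) t : E →L[ℝ] E) / Module.finrank ℝ E)
      (Ici t₀) t := by
  let tr : (E →L[ℝ] E) →ₗ[ℝ] ℝ :=
    { toFun := fun L => LinearMap.trace ℝ E L
      map_add' := fun _ _ => by simp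
      map_smul' := fun _ _ => by simp }
  have h := ((contDiffOn_weingarten hγ hp).differentiableOn (by norm_num) t ht).hasDerivWithinAt
  have h1 := ((tr.toContinuousLinearMap.hasFDerivAt (x := weingarten t₀ γ t)).comp_hasDerivWithinAt
    t h).div_const (Module.finrank ℝ E : ℝ)
  exact h1.congr (fun r _ => hubble_eq r) (hubble_eq t)

theorem raise_shear {t : ℝ} (hp : IsInnerProduct (γ t)) : raise (γ t) (shear t₀ γ t)
    = hubble t₀ γ t • ContinuousLinearMap.id ℝ E - weingarten t₀ γ t := by
  rw [shear, raise_add, raise_smul, hp.raise_self, secondForm, raise_smul, raise_derivWithin]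
  module

theorem shear_sq_eq (hn : Module.finrank ℝ E ≠ 0) (hγ : ContDiffOn ℝ 2 γ (Ici t₀))
    (hp : ∀ t ∈ Ici t₀, IsInnerProduct (γ t)) {t : ℝ} (ht : t ∈ Ici t₀) :
    tensorInner (γ t) (shear t₀ γ t) (shear t₀ γ t)
      = LinearMap.trace ℝ E ((weingarten t₀ γ t).comp (weingarten t₀ γ t))
        - Module.finrank ℝ E * hubble t₀ γ t ^ 2 := by
  have htr : LinearMap.trace ℝ E (weingarten t₀ γ t)
      = Module.finrank ℝ E * hubble t₀ γ t := by
    rw [hubble_eq]; field_simp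
  have h : (raise (γ t) (shear t₀ γ t)).comp (raise (γ t) (shear t₀ γ t))
      = (weingarten t₀ γ t).comp (weingarten t₀ γ t)
        - (2 * hubble t₀ γ t) • weingarten t₀ γ t
        + hubble t₀ γ t ^ 2 • ContinuousLinearMap.id ℝ E := by
    rw [raise_shear (hp t ht)]
    ext x
    simp
    module
  rw [tensorInner, flip_shear hγ hp ht, h]
  simp [htr]
  ring

theorem shear_sq_nonneg (hγ : ContDiffOn ℝ 2 γ (Ici t₀))
    (hp : ∀ t ∈ Ici t₀, IsInnerProduct (γ t)) {t : ℝ} (ht : t ∈ Ici t₀) :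
    0 ≤ tensorInner (γ t) (shear t₀ γ t) (shear t₀ γ t) := by
  rw [tensorInner, flip_shear hγ hp ht]
  refine (hp t ht).trace_sq_nonneg (raise (γ t) (shear t₀ γ t)) fun x y => ?_
  simp [raise_shear (hp t ht), weingarten_symm hγ hp ht x y]

/-! ### The field equations as ordinary differential equations -/

theorem metricTrace_energyMomentum {ρ : ℝ → ℝ} {j : ℝ → E →L[ℝ] ℝ} {S : ℝ → Tensor2 E} {t : ℝ}
    (hp : IsInnerProduct (γ t)) :
    metricTrace (spacetimeMetric γ t) (energyMomentum ρ j S t)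
      = metricTrace (γ t) (S t) - ρ t := by
  have : (energyMomentum ρ j S t).bilinearComp (ContinuousLinearMap.inl ℝ E ℝ)
      (ContinuousLinearMap.inl ℝ E ℝ) = S t := by
    ext x y; simp
  rw [metricTrace_spacetimeMetric hp, this]
  simp

theorem metricTrace_spacetimeMetric_self {t : ℝ} (hp : IsInnerProduct (γ t)) :
    metricTrace (spacetimeMetric γ t) (spacetimeMetric γ t) = Module.finrank ℝ E + 1 := by
  have : (spacetimeMetric γ t).bilinearComp (ContinuousLinearMap.inl ℝ E ℝ)
      (ContinuousLinearMap.inl ℝ E ℝ) = γ t := by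
    ext x y; simp
  rw [metricTrace_spacetimeMetric hp, this, metricTrace, hp.raise_self]
  simp

theorem covectorInner_differential {φ : ℝ → ℝ} {t : ℝ} (hp : IsInnerProduct (γ t)) :
    covectorInner (spacetimeMetric γ t) (differential dt (Ici t₀) φ t)
      (differential dt (Ici t₀) φ t) = -derivWithin φ (Ici t₀) t ^ 2 := by
  rw [covectorInner, sharp_spacetimeMetric hp]
  simp [differential]
  ring

theorem metricTrace_differential {φ : ℝ → ℝ} {t : ℝ} (hp : IsInnerProduct (γ t)) :
    metricTrace (spacetimeMetric γ t) (tensorProd (differential dt (Ici t₀) φ t)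
      (differential dt (Ici t₀) φ t)) = -derivWithin φ (Ici t₀) t ^ 2 := by
  have : (tensorProd (differential (dt (E := E)) (Ici t₀) φ t)
      (differential dt (Ici t₀) φ t)).bilinearComp (ContinuousLinearMap.inl ℝ E ℝ)
      (ContinuousLinearMap.inl ℝ E ℝ) = (0 : ℝ) • γ t := by
    ext x y; simp [differential]
  rw [metricTrace_spacetimeMetric hp, this, metricTrace_smul]
  simp [differential]
  ring

variable {br : E →L[ℝ] E →L[ℝ] E} {J : Set ℝ} {V C c φ ρ : ℝ → ℝ} {j : ℝ → E →L[ℝ] ℝ}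
  {S : ℝ → Tensor2 E}

/-- The Hamiltonian constraint. -/
theorem IsESMSolution.hamiltonian (hsol : IsESMSolution br J V C c t₀ γ φ ρ j S)
    (hn : Module.finrank ℝ E ≠ 0) {t : ℝ} (ht : t ∈ Ici t₀) :
    Module.finrank ℝ E * (Module.finrank ℝ E - 1) * hubble t₀ γ t ^ 2
        - derivWithin φ (Ici t₀) t ^ 2 - 2 * V (φ t)
      = tensorInner (γ t) (shear t₀ γ t) (shear t₀ γ t) - leftInvariantScalarCurvature br (γ t)
        + 2 * (C (φ t) * ρ t) := by
  have hγ := hsol.contDiffOn_metric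
  have hp := hsol.riemannian
  have htr : LinearMap.trace ℝ E (weingarten t₀ γ t)
      = Module.finrank ℝ E * hubble t₀ γ t := by
    rw [hubble_eq]; field_simp
  -- In the time-time component of the Einstein tensor the two occurrences of `tr N'` cancel, so
  -- this is a constraint and not an evolution equation.
  have h := congrArg (fun B => B (0, 1) (0, 1)) (hsol.einstein t ht)
  simp only [covectorInner_differential (hp t ht)] at h
  simp only [scalarCurvature_spacetime br hγ hp ht, sub_apply, add_apply, smul_apply, ricci_time_time br hγ hp ht, spacetimeMetric_apply,
    tensorProd_apply, energyMomentum_apply, htr, smul_eq_mul, differential, dt_apply,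
    map_zero] at h
  rw [shear_sq_eq hn hγ hp ht]
  linarith

/-- The evolution equation for the mean curvature, with the potential eliminated. -/
theorem IsESMSolution.deriv_hubble (hsol : IsESMSolution br J V C c t₀ γ φ ρ j S)
    (hn : Module.finrank ℝ E ≠ 0) {t : ℝ} (ht : t ∈ Ici t₀) :
    Module.finrank ℝ E * (Module.finrank ℝ E - 1) * derivWithin (hubble t₀ γ) (Ici t₀) t
      = -(Module.finrank ℝ E * tensorInner (γ t) (shear t₀ γ t) (shear t₀ γ t)
          + Module.finrank ℝ E * derivWithin φ (Ici t₀) t ^ 2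
          - leftInvariantScalarCurvature br (γ t)
          + C (φ t) * (Module.finrank ℝ E * ρ t + metricTrace (γ t) (S t))) := by
  have hγ := hsol.contDiffOn_metric
  have hp := hsol.riemannian
  have htr : LinearMap.trace ℝ E (weingarten t₀ γ t)
      = Module.finrank ℝ E * hubble t₀ γ t := by
    rw [hubble_eq]; field_simp
  have h := congrArg (metricTrace (spacetimeMetric γ t)) (hsol.einstein t ht)
  have hh := hsol.hamiltonian hn ht
  rw [shear_sq_eq hn hγ hp ht] at hh ⊢
  simp only [metricTrace_sub, metricTrace_add, metricTrace_smul,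
    metricTrace_spacetimeMetric_self (hp t ht), metricTrace_energyMomentum (hp t ht),
    metricTrace_differential (hp t ht), covectorInner_differential (hp t ht)] at h
  rw [← scalarCurvature, scalarCurvature_spacetime br hγ hp ht, htr] at h
  rw [(hasDerivWithinAt_hubble hγ hp ht).derivWithin (uniqueDiffOn_Ici t₀ t ht)]
  set n : ℝ := (Module.finrank ℝ E : ℝ) with hn'
  have hn0 : n ≠ 0 := by simpa [hn'] using hn
  have hmul : ∀ x : ℝ, n * (n - 1) * (x / n) = (n - 1) * x := fun x => by field_simp
  rw [hmul]
  -- The traced Einstein equation contains `-(n + 1) V` and the constraint `-2V`; this factor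
  -- matches them and eliminates `V`.
  have hh' := congrArg (fun x => (n + 1) / 2 * x) hh
  linarith

/-- The equation for the scalar field. -/
theorem IsESMSolution.deriv_deriv_field (hsol : IsESMSolution br J V C c t₀ γ φ ρ j S)
    (hn : Module.finrank ℝ E ≠ 0) {t : ℝ} (ht : t ∈ Ici t₀) :
    derivWithin (derivWithin φ (Ici t₀)) (Ici t₀) t
      = -(Module.finrank ℝ E * hubble t₀ γ t * derivWithin φ (Ici t₀) t)
        - derivWithin V J (φ t) + c (φ t) * (metricTrace (γ t) (S t) - ρ t) := by
  have htr : LinearMap.trace ℝ E (weingarten t₀ γ t)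
      = Module.finrank ℝ E * hubble t₀ γ t := by
    rw [hubble_eq]; field_simp
  have h := hsol.scalar t ht
  rw [box_spacetime br hsol.contDiffOn_metric hsol.riemannian hsol.contDiffOn_field ht,
    metricTrace_energyMomentum (hsol.riemannian t ht), htr] at h
  linarith

/-- The energy `n (n - 1) H² - φ'² - 2 V(φ)` of the shear, the spatial curvature and the matter is
`O(t⁻²)`. -/
theorem IsESMSolution.isBigO_energy (hsol : IsESMSolution br J V C c t₀ γ φ ρ j S)
    (hn : 3 ≤ Module.finrank ℝ E)
    (hbr : ∀ h : Tensor2 E, IsInnerProduct h → leftInvariantScalarCurvature br h ≤ 0)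
    (hV : ContDiffOn ℝ 1 V J) (hV0 : ∀ x ∈ J, 0 < V x) (hC : CouplingConditions J C c)
    (hE : EnergyConditions t₀ γ ρ j S) (hH : 0 < hubble t₀ γ t₀) :
    (fun t => tensorInner (γ t) (shear t₀ γ t) (shear t₀ γ t)
      - leftInvariantScalarCurvature br (γ t) + 2 * (C (φ t) * ρ t))
      =O[atTop] fun t : ℝ => t ^ (-2 : ℤ) := by
  have hγ := hsol.contDiffOn_metric
  have hp := hsol.riemannian
  have hn0 : Module.finrank ℝ E ≠ 0 := by omega
  have hn3 : (3 : ℝ) ≤ Module.finrank ℝ E := by exact_mod_cast hn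
  obtain ⟨C₀, hC₀⟩ := hC.bound
  have hham := fun t (ht : t ∈ Ici t₀) => hsol.hamiltonian hn0 ht
  have hdH := fun t (ht : t ∈ Ici t₀) => hsol.deriv_hubble hn0 ht
  have hdφ := fun t (ht : t ∈ Ici t₀) => hsol.deriv_deriv_field hn0 ht
  set n : ℝ := (Module.finrank ℝ E : ℝ) with hn'
  set H := hubble t₀ γ with hHdef
  set ψ := derivWithin φ (Ici t₀) with hψ
  have hHd : ∀ t ∈ Ici t₀, HasDerivWithinAt H (derivWithin H (Ici t₀) t) (Ici t₀) t :=
    fun t ht => (hasDerivWithinAt_hubble hγ hp ht).differentiableWithinAt.hasDerivWithinAt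
  have hφd : ∀ t ∈ Ici t₀, HasDerivWithinAt φ (ψ t) (Ici t₀) t := fun t ht =>
    (hsol.contDiffOn_field.differentiableOn (by norm_num) t ht).hasDerivWithinAt
  have hψd : ∀ t ∈ Ici t₀, HasDerivWithinAt ψ (derivWithin ψ (Ici t₀) t) (Ici t₀) t :=
    fun t ht => ((hsol.contDiffOn_field.derivWithin (uniqueDiffOn_Ici t₀)
      (by norm_num)).differentiableOn one_ne_zero t ht).hasDerivWithinAt
  have hVd : ∀ t ∈ Ici t₀, HasDerivWithinAt (fun r => V (φ r)) (derivWithin V J (φ t) * ψ t)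
      (Ici t₀) t := fun t ht =>
    ((hV.differentiableOn one_ne_zero _ (hsol.mapsTo_field ht)).hasDerivWithinAt).comp t
      (hφd t ht) hsol.mapsTo_field
  have hσ : ∀ t ∈ Ici t₀, 0 ≤ tensorInner (γ t) (shear t₀ γ t) (shear t₀ γ t) :=
    fun t ht => shear_sq_nonneg hγ hp ht
  have hR : ∀ t ∈ Ici t₀, leftInvariantScalarCurvature br (γ t) ≤ 0 := fun t ht => hbr _ (hp t ht)
  have hρ : ∀ t ∈ Ici t₀, 0 ≤ ρ t := fun t ht => (Real.sqrt_nonneg _).trans (hE.dominant_flow t ht)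
  have hCn : ∀ t ∈ Ici t₀, 0 ≤ C (φ t) := fun t ht => hC.nonneg _ (hsol.mapsTo_field ht)
  have hVp : ∀ t ∈ Ici t₀, 0 < V (φ t) := fun t ht => hV0 _ (hsol.mapsTo_field ht)
  have hCρ : ∀ t ∈ Ici t₀, 0 ≤ C (φ t) * ρ t := fun t ht => mul_nonneg (hCn t ht) (hρ t ht)
  -- At a zero of `H` the constraint would equate `-ψ² - 2V < 0` with `Q ≥ 0`.
  have hne : ∀ t ∈ Ici t₀, H t ≠ 0 := by
    intro t ht h0
    have := hham t ht
    rw [h0] at this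
    linarith [hσ t ht, hR t ht, hCρ t ht, hVp t ht, sq_nonneg (ψ t)]
  have hpos : ∀ t ∈ Ici t₀, 0 < H t := by
    intro t ht
    by_contra! h
    obtain ⟨s, hs, hs0⟩ := intermediate_value_Icc' (f := H) ht
      (fun s hs => (hHd s hs.1).continuousWithinAt.mono Icc_subset_Ici_self) ⟨h, hH.le⟩
    exact hne s hs.1 hs0
  set Q : ℝ → ℝ := fun t => tensorInner (γ t) (shear t₀ γ t) (shear t₀ γ t)
      - leftInvariantScalarCurvature br (γ t) + 2 * (C (φ t) * ρ t) with hQ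
  have hQ0 : ∀ t ∈ Ici t₀, 0 ≤ Q t := fun t ht => by
    simp only [hQ]; linarith [hσ t ht, hR t ht, hCρ t ht]
  -- Positive times are needed for the powers of `t` in the decay lemma.
  set a := max t₀ 1 with ha
  have hsub : Ici a ⊆ Ici t₀ := Ici_subset_Ici.2 (le_max_left _ _)
  have ha0 : 0 < a := one_pos.trans_le (le_max_right _ _)
  have hn1 : 0 < n - 1 := by linarith
  have hB : ∃ B, ∀ t ∈ Ici a, t ^ 2 * Q t ≤ B := by
    refine exists_sq_mul_le_of_deriv_le (H := H) (H' := derivWithin H (Ici t₀)) (Q := Q)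
      (Q' := fun t => n * (n - 1) * (2 * H t * derivWithin H (Ici t₀) t)
        - 2 * ψ t * derivWithin ψ (Ici t₀) t - 2 * (derivWithin V J (φ t) * ψ t)) (ψ := ψ)
      (a := a) (b := 1 / (n - 1)) (m := n * (n - 1)) (c := |C₀| * (n + 1)) ha0 (by positivity)
      (fun t ht => (hHd t (hsub ht)).mono hsub) (fun t ht => ?_)
      (fun t ht => hpos t (hsub ht)) (fun t ht => hQ0 t (hsub ht)) (fun t ht => ?_)
      (fun t ht => ?_) (fun t ht => ?_)
    · have h1 := ((((hHd t (hsub ht)).pow 2).const_mul (n * (n - 1))).sub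
        ((hψd t (hsub ht)).pow 2)).sub ((hVd t (hsub ht)).const_mul 2)
      have h2 := h1.congr (f₁ := Q) (fun r hr => (hham r hr).symm) (hham t (hsub ht)).symm
      refine (h2.mono hsub).congr_deriv ?_
      simp
    · have := hham t (hsub ht)
      simp only [hQ]
      linarith [hVp t (hsub ht), sq_nonneg (ψ t)]
    · have h1 := hdH t (hsub ht)
      have h2 : 0 ≤ C (φ t) * (n * ρ t + metricTrace (γ t) (S t)) :=
        mul_nonneg (hCn t (hsub ht)) (by
          linarith [(abs_le.1 (hE.dominant_pressure t (hsub ht))).1])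
      have h3 : 0 ≤ n * tensorInner (γ t) (shear t₀ γ t) (shear t₀ γ t) :=
        mul_nonneg (by linarith) (hσ t (hsub ht))
      have h4 : n * ((n - 1) * derivWithin H (Ici t₀) t) ≤ n * (-ψ t ^ 2) := by
        linarith [hR t (hsub ht)]
      have h5 := le_of_mul_le_mul_left h4 (by linarith)
      rw [neg_mul, one_div, inv_mul_eq_div, ← neg_div, le_div_iff₀ hn1]
      linarith
    · have ht' := hsub ht
      have hs := hE.strong t ht'
      have hd := abs_le.1 (hE.dominant_pressure t ht')
      -- The friction term of the field equation cancels the `ψ²` term of `2n(n-1)HH'`, and `V'`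
      -- cancels the derivative of the potential.
      rw [hdφ t ht']
      have e1 : n * (n - 1) * (2 * H t * derivWithin H (Ici t₀) t)
          = 2 * H t * (n * (n - 1) * derivWithin H (Ici t₀) t) := by ring
      rw [e1, hdH t ht']
      -- The matter part needs `nρ + tr S ≥ 2ρ`, that is `(n - 3)ρ + (ρ + tr S) ≥ 0`: dimension at
      -- least three together with `hE.strong`.
      have e2 : Q t ≤ n * tensorInner (γ t) (shear t₀ γ t) (shear t₀ γ t)
          - leftInvariantScalarCurvature br (γ t)
          + C (φ t) * (n * ρ t + metricTrace (γ t) (S t)) := by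
        have f1 : 0 ≤ (n - 1) * tensorInner (γ t) (shear t₀ γ t) (shear t₀ γ t) :=
          mul_nonneg hn1.le (hσ t ht')
        have f2 : 0 ≤ C (φ t) * (ρ t + metricTrace (γ t) (S t)) := mul_nonneg (hCn t ht') hs
        have f3 : 0 ≤ (n - 3) * (C (φ t) * ρ t) := mul_nonneg (by linarith) (hCρ t ht')
        simp only [hQ]
        linarith
      have e3 := mul_le_mul_of_nonneg_left e2 (hpos t ht').le
      have e4 : |c (φ t) * (metricTrace (γ t) (S t) - ρ t)|
          ≤ |C₀| * (n + 1) * (C (φ t) * ρ t) := by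
        rw [abs_mul]
        have f1 : |metricTrace (γ t) (S t) - ρ t| ≤ (n + 1) * ρ t := by
          rw [abs_le]; constructor <;> linarith [hρ t ht', hd.1, hd.2]
        have f2 : |c (φ t)| ≤ |C₀| * C (φ t) := (hC₀ _ (hsol.mapsTo_field ht')).trans
          (mul_le_mul_of_nonneg_right (le_abs_self _) (hCn t ht'))
        calc _ ≤ |C₀| * C (φ t) * ((n + 1) * ρ t) :=
              mul_le_mul f2 f1 (abs_nonneg _) (mul_nonneg (abs_nonneg _) (hCn t ht'))
          _ = _ := by ring
      -- The factor 2 in the cross term `2ψ c(φ) tr T` is absorbed here, leaving the constant `|C₀|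
      -- (n + 1)`.
      have e5 : 2 * (C (φ t) * ρ t) ≤ Q t := by
        simp only [hQ]; linarith [hσ t ht', hR t ht']
      have e6 : -(ψ t * (c (φ t) * (metricTrace (γ t) (S t) - ρ t)))
          ≤ |ψ t| * (|C₀| * (n + 1) * (C (φ t) * ρ t)) := by
        refine (neg_le_abs _).trans ?_
        rw [abs_mul]
        exact mul_le_mul_of_nonneg_left e4 (abs_nonneg _)
      have e7 : |ψ t| * (|C₀| * (n + 1)) * (2 * (C (φ t) * ρ t))
          ≤ |ψ t| * (|C₀| * (n + 1)) * Q t :=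
        mul_le_mul_of_nonneg_left e5 (by positivity)
      linarith
  obtain ⟨B, hB⟩ := hB
  refine IsBigO.of_bound B ?_
  filter_upwards [eventually_ge_atTop a] with t ht
  have h0 : 0 < t := ha0.trans_le ht
  rw [Real.norm_of_nonneg (hQ0 t (hsub ht)), Real.norm_of_nonneg (by positivity), zpow_neg,
    ← div_eq_mul_inv, le_div_iff₀ (by positivity)]
  have := hB t ht
  rw [mul_comm] at this
  exact_mod_cast this

end FieldEquations

end Quintessence

theorem mainTheorem7
    {E : Type*} [NormedAddCommGroup E] [NormedSpace ℝ E] [FiniteDimensional ℝ E]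
    (hn : 3 ≤ Module.finrank ℝ E)
    {G : Type*} [TopologicalSpace G] [ChartedSpace E G] [Group G] [LieGroup 𝓘(ℝ, E) ∞ G]
    (hG : ∀ h : Quintessence.Tensor2 E, Quintessence.IsInnerProduct h →
      Quintessence.leftInvariantScalarCurvature (Quintessence.lieBracket E G) h ≤ 0)
    (J : Set ℝ) (hJ : J.OrdConnected) (hJ' : (interior J).Nonempty)
    (V C c : ℝ → ℝ)
    (hV : Quintessence.PotentialConditions J V)
    (hC : Quintessence.CouplingConditions J C c)
    (t₀ : ℝ) (γ : ℝ → Quintessence.Tensor2 E) (φ ρ : ℝ → ℝ) (j : ℝ → E →L[ℝ] ℝ)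
    (S : ℝ → Quintessence.Tensor2 E)
    (hsol : Quintessence.IsESMSolution (Quintessence.lieBracket E G) J V C c t₀ γ φ ρ j S)
    (hE : Quintessence.EnergyConditions t₀ γ ρ j S)
    (hH : 0 < Quintessence.hubble t₀ γ t₀) :
    ((fun t => Quintessence.leftInvariantScalarCurvature (Quintessence.lieBracket E G) (γ t))
        =O[atTop] fun t : ℝ => t ^ (-2 : ℤ)) ∧
    ((fun t => Quintessence.tensorInner (γ t) (Quintessence.shear t₀ γ t)
          (Quintessence.shear t₀ γ t))
        =O[atTop] fun t : ℝ => t ^ (-2 : ℤ)) ∧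
    ((fun t => C (φ t) * ρ t) =O[atTop] fun t : ℝ => t ^ (-2 : ℤ)) ∧
    ((fun t => C (φ t) * √(Quintessence.covectorInner (γ t) (j t) (j t)))
        =O[atTop] fun t : ℝ => t ^ (-2 : ℤ)) ∧
    ((fun t => C (φ t) * Quintessence.metricTrace (γ t) (S t))
        =O[atTop] fun t : ℝ => t ^ (-2 : ℤ)) ∧
    ((fun t => c (φ t) * Quintessence.metricTrace (Quintessence.spacetimeMetric γ t)
          (Quintessence.energyMomentum ρ j S t))
        =O[atTop] fun t : ℝ => t ^ (-2 : ℤ)) := by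
  have hQ := hsol.isBigO_energy hn hG hV.contDiffOn hV.pos hC hE hH
  have hn0 : (0 : ℝ) ≤ Module.finrank ℝ E := Nat.cast_nonneg _
  obtain ⟨C₀, hC₀⟩ := hC.bound
  -- Reduces each claim to a pointwise bound by a multiple of the energy.
  have key : ∀ (f : ℝ → ℝ) (D : ℝ), (∀ t ∈ Ici t₀,
      |f t| ≤ D * (Quintessence.tensorInner (γ t) (Quintessence.shear t₀ γ t)
          (Quintessence.shear t₀ γ t)
        - Quintessence.leftInvariantScalarCurvature (Quintessence.lieBracket E G) (γ t)
        + 2 * (C (φ t) * ρ t))) → f =O[atTop] fun t : ℝ => t ^ (-2 : ℤ) := by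
    intro f D hf
    refine IsBigO.trans (IsBigO.of_bound |D| ?_) hQ
    filter_upwards [eventually_ge_atTop t₀] with t ht
    refine (hf t ht).trans ((le_abs_self _).trans ?_)
    rw [abs_mul, Real.norm_eq_abs]
  have hσ : ∀ t ∈ Ici t₀, 0 ≤ Quintessence.tensorInner (γ t) (Quintessence.shear t₀ γ t)
      (Quintessence.shear t₀ γ t) := fun t ht =>
    Quintessence.shear_sq_nonneg hsol.contDiffOn_metric hsol.riemannian ht
  have hR := fun t (ht : t ∈ Ici t₀) => hG _ (hsol.riemannian t ht)
  have hρ : ∀ t ∈ Ici t₀, 0 ≤ ρ t := fun t ht => (Real.sqrt_nonneg _).trans (hE.dominant_flow t ht)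
  have hCn : ∀ t ∈ Ici t₀, 0 ≤ C (φ t) := fun t ht => hC.nonneg _ (hsol.mapsTo_field ht)
  have hCρ : ∀ t ∈ Ici t₀, 0 ≤ C (φ t) * ρ t := fun t ht => mul_nonneg (hCn t ht) (hρ t ht)
  have hle : ∀ t ∈ Ici t₀, C (φ t) * ρ t ≤
      Quintessence.tensorInner (γ t) (Quintessence.shear t₀ γ t) (Quintessence.shear t₀ γ t)
        - Quintessence.leftInvariantScalarCurvature (Quintessence.lieBracket E G) (γ t)
        + 2 * (C (φ t) * ρ t) := fun t ht => by
    linarith [hσ t ht, hR t ht, hCρ t ht]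
  -- The constant `n` comes from `|tr S| ≤ nρ`; the last one from `|c| ≤ |C₀| C` and `|tr_g T| = |tr
  -- S - ρ| ≤ (n + 1)ρ`.
  refine ⟨key _ 1 fun t ht => ?_, key _ 1 fun t ht => ?_, key _ 1 fun t ht => ?_,
    key _ 1 fun t ht => ?_, key _ (Module.finrank ℝ E) fun t ht => ?_,
    key _ (|C₀| * (Module.finrank ℝ E + 1)) fun t ht => ?_⟩
  · rw [abs_of_nonpos (hR t ht)]
    linarith [hσ t ht, hCρ t ht]
  · rw [abs_of_nonneg (hσ t ht)]
    linarith [hR t ht, hCρ t ht]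
  · rw [abs_of_nonneg (hCρ t ht), one_mul]
    exact hle t ht
  · rw [abs_of_nonneg (mul_nonneg (hCn t ht) (Real.sqrt_nonneg _)), one_mul]
    exact (mul_le_mul_of_nonneg_left (hE.dominant_flow t ht) (hCn t ht)).trans (hle t ht)
  · rw [abs_mul, abs_of_nonneg (hCn t ht)]
    calc _ ≤ C (φ t) * (Module.finrank ℝ E * ρ t) :=
          mul_le_mul_of_nonneg_left (hE.dominant_pressure t ht) (hCn t ht)
      _ = Module.finrank ℝ E * (C (φ t) * ρ t) := by ring
      _ ≤ _ := mul_le_mul_of_nonneg_left (hle t ht) hn0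
  · have hd := abs_le.1 (hE.dominant_pressure t ht)
    rw [Quintessence.metricTrace_energyMomentum (hsol.riemannian t ht), abs_mul]
    have h1 : |Quintessence.metricTrace (γ t) (S t) - ρ t| ≤ (Module.finrank ℝ E + 1) * ρ t := by
      rw [abs_le]; constructor <;> linarith [hρ t ht, hd.1, hd.2]
    have h2 : |c (φ t)| ≤ |C₀| * C (φ t) := (hC₀ _ (hsol.mapsTo_field ht)).trans
      (mul_le_mul_of_nonneg_right (le_abs_self _) (hCn t ht))
    calc _ ≤ |C₀| * C (φ t) * ((Module.finrank ℝ E + 1) * ρ t) :=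
          mul_le_mul h2 h1 (abs_nonneg _) (mul_nonneg (abs_nonneg _) (hCn t ht))
      _ = |C₀| * (Module.finrank ℝ E + 1) * (C (φ t) * ρ t) := by ring
      _ ≤ _ := mul_le_mul_of_nonneg_left (hle t ht) (by positivity)
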